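/- Fix the following notions. An $n$-qubit circuit ($n\ge 1$) is a finite sequence of gates applied to the input $|0\rangle^{n}$ and followed by a standard basis measurement of the first qubit. A gate is one of the following single-qubit gates, applied to a target qubit and possibly controlled on other qubits being $|1\rangle$: Hadamard, the $\pi/8$-phase gate $\mathrm{diag}(1,e^{i\pi/4})$, NOT, or a real rotation $|0\rangle\mapsto\sqrt{1-\varepsilon}\,|0\rangle+\sqrt{\varepsilon}\,|1\rangle$, $|1\rangle\mapsto-\sqrt{\varepsilon}\,|0\rangle+\sqrt{1-\varepsilon}\,|1\rangle$ with $\varepsilon=(a+1)^{-b}$, $a,b\in\mathbb N$. A family of circuits $(\mathcal C_x)$ indexed by binary words $x$ is uniform if a Turing machine writes a description of $\mathcal C_x$ (with all natural numbers, including the number of qubits, in unary) in time polynomial in $|x|$. A promise problem is a pair of disjoint sets of binary words (yes-instances, no-instances); a decision problem is the case where they are complementary. It is in BQP if there is a uniform family of circuits $\mathcal C_x$ composed of Hadamard, $\pi/8$-phase and CNOT gates whose measurement gives $1$ with probability at least $2/3$ on every yes-instance $x$ and at most $1/3$ on every no-instance $x$. For a pure state $|\psi\rangle$ of $n$ qubits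 and a bipartition $(A,B)$ of the qubits, the entanglement entropy is $E^{A,B}(|\psi\rangle)=-\mathrm{Tr}\,\rho^A\log_2\rho^A$, where $\rho^A$ is the reduced density operator of $|\psi\rangle$ on $A$. A family $(\delta_n)_{n\ge 1}$ of positive reals is polynomially small if $1/\delta_n=O(p(n))$ for some polynomial $p$. **Observation 2.** Let $(\delta_n)$ be polynomially small. Then every problem in BQP can be solved efficiently by a pure-state circuit model in which, throughout the entire computation, the entanglement entropy of every $n$-qubit state is at most $O(\delta_n)$ for every bipartition. Precisely: there is a constant $C>0$, depending only on $(\delta_n)$, such that for every promise problem in BQP there are a uniform family of circuits $\mathcal C_x$, on $n_x$ qubits, of gates acting on at most three qubits each, and polynomials $r,s$ with coefficients in $\mathbb N$, such that: 1. for every $x$, the state $|\psi_t\rangle$ of the register after the first $t$ gates of $\mathcal C_x$ satisfies $E^{A,B}(|\psi_t\rangle)\le C\,\delta_{n_x}$ for every $t$ from $0$ to the number of gates and for every bipartition $(A,B)$ of the $n_x$ qubits; 2. running $\mathcal C_x$ independently $r(n_x)$ times, and answering "yes" if and only if at least $s(n_x)$ of the measurement outcomes are $1$, gives the answer "yes"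 with probability at least $2/3$ on every yes-instance $x$ and at most $1/3$ on every no-instance $x$. -/

import Mathlib

noncomputable section

namespace LowEntQC

/-! ### Pure states of a register of qubits, and their entanglement entropies -/

/-- Amplitudes, in the computational basis, of a vector in the space of `n` qubits. -/
abbrev StateVec (n : ℕ) : Type := (Fin n → Bool) → ℂ

/-- The input state `|0⟩ⁿ`. -/
def zeroState (n : ℕ) : StateVec n := fun x => if x = (fun _ => false) then 1 else 0

/-- The basis label that is `x` on the qubits in `A` and `z` on the remaining qubits. -/
def glue {n : ℕ} (A : Finset (Fin n)) (x : {i // i ∈ A} → Bool) (z : {i // i ∉ A} → Bool) :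
    Fin n → Bool :=
  fun i => if h : i ∈ A then x ⟨i, h⟩ else z ⟨i, h⟩

/-- The reduced density operator `ρ^A` of `|ψ⟩⟨ψ|`: all qubits outside `A` are traced out. -/
def reduced {n : ℕ} (ψ : StateVec n) (A : Finset (Fin n)) :
    Matrix ({i // i ∈ A} → Bool) ({i // i ∈ A} → Bool) ℂ :=
  Matrix.of fun x y => ∑ z : {i // i ∉ A} → Bool, ψ (glue A x z) * star (ψ (glue A y z))

theorem reduced_isHermitian {n : ℕ} (ψ : StateVec n) (A : Finset (Fin n)) :
    (reduced ψ A).IsHermitian := by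
  ext x y
  simp [reduced, Matrix.conjTranspose_apply, mul_comm]

/-- The von Neumann entropy `- Tr ρ log₂ ρ` of a Hermitian matrix, through its eigenvalues
(with `0 log 0 = 0`). -/
def vonNeumannEntropy {ι : Type*} [Fintype ι] [DecidableEq ι] {ρ : Matrix ι ι ℂ}
    (hρ : ρ.IsHermitian) : ℝ :=
  -∑ i, hρ.eigenvalues i * Real.logb 2 (hρ.eigenvalues i)

/-- The entanglement entropy of `ψ` across the bipartition `(A, Aᶜ)` of the qubits. -/
def entanglementEntropy {n : ℕ} (ψ : StateVec n) (A : Finset (Fin n)) : ℝ :=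
  vonNeumannEntropy (reduced_isHermitian ψ A)

/-! ### Gates and circuits -/

/-- Types of single-qubit gates: Hadamard, the `π/8`-phase gate, NOT, and the real rotations
by the angle whose sine is the square root of `ε = 1 / (a + 1) ^ b`. -/
inductive Kind : Type
  | had : Kind
  | phase : Kind
  | flip : Kind
  | rot (a b : ℕ) : Kind

/-- The squared sine of the angle of a rotation gate. -/
def rotEps (a b : ℕ) : ℝ := 1 / ((a : ℝ) + 1) ^ b

/-- The matrix of a single-qubit gate; `false` stands for `|0⟩` and `true` for `|1⟩`. -/
def Kind.matrix : Kind → Matrix Bool Bool ℂ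
  | .had => Matrix.of fun x y => if x && y then -((1 / √2 : ℝ) : ℂ) else ((1 / √2 : ℝ) : ℂ)
  | .phase => Matrix.of fun x y =>
      if x = y then (if x then Complex.exp (Real.pi / 4 * Complex.I) else 1) else 0
  | .flip => Matrix.of fun x y => if x = y then 0 else 1
  | .rot a b => Matrix.of fun x y =>
      if x = y then ((√(1 - rotEps a b) : ℝ) : ℂ)
      else if x then ((√(rotEps a b) : ℝ) : ℂ) else -((√(rotEps a b) : ℝ) : ℂ)

/-- A gate on a register of `n` qubits: the single-qubit gate `kind` acts on the qubit `target`,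
controlled on all the qubits in `controls` being in the state `|1⟩`. -/
structure Gate (n : ℕ) : Type where
  kind : Kind
  target : Fin n
  controls : List (Fin n)
  distinct : (target :: controls).Nodup

/-- The number of qubits on which a gate acts. -/
def Gate.arity {n : ℕ} (g : Gate n) : ℕ := g.controls.length + 1

/-- The gates of the universal set consisting of the Hadamard gate, the `π/8`-phase gate and
CNOT. -/
def Gate.IsBasic {n : ℕ} (g : Gate n) : Prop :=
  (g.kind = .had ∧ g.arity = 1) ∨ (g.kind = .phase ∧ g.arity = 1) ∨
    (g.kind = .flip ∧ g.arity = 2)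

/-- The action of a gate on a state. -/
def Gate.apply {n : ℕ} (g : Gate n) (ψ : StateVec n) : StateVec n := fun x =>
  if ∀ c ∈ g.controls, x c = true then
    ∑ b : Bool, g.kind.matrix (x g.target) b * ψ (Function.update x g.target b)
  else ψ x

/-- A circuit: a nonempty register of `n` qubits and a finite sequence of gates. -/
structure Circuit : Type where
  n : ℕ
  pos : 0 < n
  gates : List (Gate n)

/-- The state of the register after the first `t` gates, on the input `|0⟩ⁿ`. -/
def Circuit.stateAfter (C : Circuit) (t : ℕ) : StateVec C.n :=
  (C.gates.take t).foldl (fun ψ g => g.apply ψ) (zeroState C.n)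

/-- The probability that the standard basis measurement of the first qubit, after all gates,
gives the outcome `1`. -/
def Circuit.probOne (C : Circuit) : ℝ :=
  ∑ x : Fin C.n → Bool,
    if x ⟨0, C.pos⟩ = true then ‖C.stateAfter C.gates.length x‖ ^ 2 else 0

/-- The probability that, in `T` independent runs of `C`, at least `θ` of the `T` measurement
outcomes are `1`. -/
def Circuit.probAtLeast (C : Circuit) (T θ : ℕ) : ℝ :=
  ∑ k ∈ Finset.Icc θ T, (T.choose k : ℝ) * C.probOne ^ k * (1 - C.probOne) ^ (T - k)

/-! ### Descriptions of circuits as words, and uniformity -/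

/-- The alphabet in which circuits are written down. -/
inductive Sym : Type
  | one | had | phase | flip | rot | exponent | target | control
  deriving DecidableEq

/-- Natural numbers are written in unary. -/
def unary (k : ℕ) : List Sym := List.replicate k Sym.one

def Kind.encode : Kind → List Sym
  | .had => [.had]
  | .phase => [.phase]
  | .flip => [.flip]
  | .rot a b => Sym.rot :: unary a ++ Sym.exponent :: unary b

def Gate.encode {n : ℕ} (g : Gate n) : List Sym :=
  g.kind.encode ++ Sym.target :: unary g.target ++
    g.controls.flatMap (fun c => Sym.control :: unary c)

/-- The description of a circuit: the number of qubits, then the gates in order. Numbers being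
in unary, a circuit with a description of length `ℓ` has at most `ℓ` qubits and gates. -/
def Circuit.encode (C : Circuit) : List Sym :=
  unary C.n ++ C.gates.flatMap Gate.encode

/-- The circuit family `F` is polynomial-time uniform: a Turing machine writes the description of
`F x` on the input word `x` in time polynomial in the length of `x`. -/
def PolyTimeUniform (F : List Bool → Circuit) : Prop :=
  Nonempty (Turing.TM2ComputableInPolyTime (id : List Bool → List Bool) Circuit.encode F)

/-! ### Decision problems and their efficient solution -/

/-- A promise problem on binary words (a decision problem when `no = yesᶜ`). -/
structure PromiseProblem : Type where
  yes : Set (List Bool)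
  no : Set (List Bool)
  disjoint : Disjoint yes no

/-- The class BQP, with circuits over the Hadamard, `π/8`-phase and CNOT gates. -/
def InBQP (P : PromiseProblem) : Prop :=
  ∃ F : List Bool → Circuit, PolyTimeUniform F ∧
    (∀ x, ∀ g ∈ (F x).gates, g.IsBasic) ∧
    (∀ x ∈ P.yes, 2 / 3 ≤ (F x).probOne) ∧
    (∀ x ∈ P.no, (F x).probOne ≤ 1 / 3)

/-- In every step of the computation, the entanglement entropy across every bipartition of the
register is at most `β`. -/
def Circuit.EntropyAtMost (C : Circuit) (β : ℝ) : Prop :=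
  ∀ t ≤ C.gates.length, ∀ A : Finset (Fin C.n), entanglementEntropy (C.stateAfter t) A ≤ β

/-- `P` is efficiently solvable, with error probability at most `1/3`, by a quantum computer that
runs circuits of gates on at most three qubits and in which the entanglement entropies of every
state of the `n`-qubit register are at most `β n`. On the input `x`, a circuit `F x` is computed
in polynomial time and is run a number of times that is polynomial in its number of qubits; the
answer is 'yes' when the number of outcomes `1` reaches a threshold, also given by a polynomial. -/
def SolvableWithEntropyAtMost (β : ℕ → ℝ) (P : PromiseProblem) : Prop :=
  ∃ F : List Bool → Circuit, PolyTimeUniform F ∧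
    (∀ x, ∀ g ∈ (F x).gates, g.arity ≤ 3) ∧
    (∀ x, (F x).EntropyAtMost (β (F x).n)) ∧
    ∃ runs threshold : Polynomial ℕ,
      (∀ x ∈ P.yes,
        2 / 3 ≤ (F x).probAtLeast (runs.eval (F x).n) (threshold.eval (F x).n)) ∧
      (∀ x ∈ P.no,
        (F x).probAtLeast (runs.eval (F x).n) (threshold.eval (F x).n) ≤ 1 / 3)

/-- A family of parameters `δ₁, δ₂, …` is polynomially small if all are positive and
`1 / δₙ = O(p(n))` for some polynomial `p`. -/
def PolynomiallySmall (δ : ℕ → ℝ) : Prop :=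
  (∀ n, 1 ≤ n → 0 < δ n) ∧
    ∃ p : Polynomial ℝ,
      Asymptotics.IsBigO Filter.atTop (fun n : ℕ => 1 / δ n) (fun n : ℕ => p.eval (n : ℝ))

end LowEntQC

end

/-! Given a circuit `C` on `m` qubits, add a qubit, rotate it by a small angle so that it is in the
state `√(1 - ε) |0⟩ + √ε |1⟩`, and run `C` on the old register controlled on the new qubit. Only the
branch of weight `ε` computes anything, so all states of the computation remain `ε`-close to
`|0…0⟩`. A reduced density operator then has an eigenvalue of at least `1 - ε`, and its entropy is
`O(ε (n + log (1 / ε)))`; with `n = m + 1` and `ε = n ^ (-b)` for `b` large this is below a given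
polynomially small bound. The new qubit is finally set to `|0⟩` in the active branch when `C`
rejects, so that measuring it gives `1` with probability `ε` times the acceptance probability
of `C`, and by Chebyshev's inequality `O(1 / ε)` independent runs are enough to recover the
answer.

The description of the new circuit is obtained from that of `C` by a substitution on symbols
followed by a finite number of insertions, so uniformity reduces to the closure of polynomial time
under composition, for which the two machines are run one after the other on disjoint sets of
stacks. -/

namespace LowEntQC

open Turing Function

/-! ### Runs of stack machines -/

/-- `b` is reached from `a` in exactly `n` steps of the partial map `f`: the propositional form of
`StateTransition.EvalsTo`, with the number of steps exposed. -/
def ReachesIn {σ : Type*} (f : σ → Option σ) (n : ℕ) (a b : σ) : Prop :=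
  (flip bind f)^[n] (some a) = some b

section ReachesIn

variable {σ τ : Type*} {f : σ → Option σ} {g : τ → Option τ} {m n : ℕ} {a b c : σ}

theorem ReachesIn.refl (f : σ → Option σ) (a : σ) : ReachesIn f 0 a a := rfl

theorem ReachesIn.trans (hab : ReachesIn f m a b) (hbc : ReachesIn f n b c) :
    ReachesIn f (m + n) a c := by
  unfold ReachesIn at *
  rw [add_comm, iterate_add_apply, hab, hbc]

theorem ReachesIn.single (hab : f a = some b) : ReachesIn f 1 a b := hab

theorem ReachesIn.head (hab : f a = some b) (hbc : ReachesIn f n b c) :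
    ReachesIn f (n + 1) a c := by
  rw [add_comm]
  exact (ReachesIn.single hab).trans hbc

theorem ReachesIn.exists_of_succ (h : ReachesIn f (n + 1) a c) :
    ∃ b, f a = some b ∧ ReachesIn f n b c := by
  change (flip bind f)^[n] (f a) = some c at h
  cases hb : f a with
  | none => rw [hb, iterate_fixed rfl] at h; cases h
  | some b => exact ⟨b, rfl, by rwa [hb] at h⟩

theorem ReachesIn.map (φ : σ → τ) (hφ : ∀ a b, f a = some b → g (φ a) = some (φ b))
    (h : ReachesIn f n a b) : ReachesIn g n (φ a) (φ b) := by
  induction n generalizing a with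
  | zero => cases h; exact ReachesIn.refl _ _
  | succ n ih =>
    obtain ⟨c, hc, h⟩ := h.exists_of_succ
    exact (ih h).head (hφ _ _ hc)

theorem ReachesIn.measure_le (μ : σ → ℕ) (c : ℕ) (hμ : ∀ a b, f a = some b → μ b ≤ μ a + c)
    (h : ReachesIn f n a b) : μ b ≤ μ a + n * c := by
  induction n generalizing a with
  | zero => cases h; simp
  | succ n ih =>
    obtain ⟨d, hd, h⟩ := h.exists_of_succ
    linarith [ih h, hμ _ _ hd]

end ReachesIn

theorem initList_eq (M : FinTM2) (w : List (M.Γ M.k₀)) :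
    initList M w = ⟨some M.main, M.initialState, update (fun _ => []) M.k₀ w⟩ := by
  refine congrArg (TM2.Cfg.mk _ _) (funext fun k => ?_)
  by_cases h : k = M.k₀
  · subst h; simp
  · simp [h]

theorem haltList_eq (M : FinTM2) (w : List (M.Γ M.k₁)) :
    haltList M w = ⟨none, M.initialState, update (fun _ => []) M.k₁ w⟩ := by
  refine congrArg (TM2.Cfg.mk _ _) (funext fun k => ?_)
  by_cases h : k = M.k₁
  · subst h; simp
  · simp [h]

section Statements

variable {K : Type*} [DecidableEq K] {Γ : K → Type*} {Λ σ : Type*}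

/-- The number of push instructions in a statement, an upper bound for the growth of each stack when
the statement is executed. -/
def pushCount {K : Type*} {Γ : K → Type*} {Λ σ : Type*} : TM2.Stmt Γ Λ σ → ℕ
  | .push _ _ q => pushCount q + 1
  | .peek _ _ q => pushCount q
  | .pop _ _ q => pushCount q
  | .load _ q => pushCount q
  | .branch _ q₁ q₂ => pushCount q₁ + pushCount q₂
  | .goto _ => 0
  | .halt => 0

theorem length_stepAux_le (q : TM2.Stmt Γ Λ σ) (v : σ) (S : ∀ k, List (Γ k)) (k : K) :
    ((TM2.stepAux q v S).stk k).length ≤ (S k).length + pushCount q := by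
  induction q generalizing v S with
  | push k' f q ih =>
    refine (ih _ _).trans ?_
    obtain rfl | h := eq_or_ne k k'
    · simp [pushCount, add_assoc, add_comm 1]
    · simp only [update_of_ne h, pushCount]; omega
  | peek _ _ _ ih => exact ih _ _
  | pop k' f q ih =>
    refine (ih _ _).trans ?_
    obtain rfl | h := eq_or_ne k k'
    · simp [pushCount]
    · simp [pushCount, h]
  | load _ _ ih => exact ih _ _
  | branch f q₁ q₂ ih₁ ih₂ =>
    rw [TM2.stepAux, pushCount]
    cases f v
    · exact (ih₂ _ _).trans (by omega)
    · exact (ih₁ _ _).trans (by omega)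
  | goto f => simp [pushCount]
  | halt => simp [pushCount]

/-- Push the symbols of `w` one after another, so that the last one ends up on top. -/
def pushList {K : Type*} {Γ : K → Type*} {Λ σ : Type*} (k : K) (w : List (Γ k))
    (q : TM2.Stmt Γ Λ σ) : TM2.Stmt Γ Λ σ :=
  w.foldr (fun a q => .push k (fun _ => a) q) q

theorem stepAux_pushList (k : K) (w : List (Γ k)) (q : TM2.Stmt Γ Λ σ) (v : σ)
    (S : ∀ k, List (Γ k)) :
    TM2.stepAux (pushList k w q) v S = TM2.stepAux q v (update S k (w.reverse ++ S k)) := by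
  induction w generalizing S with
  | nil => simp [pushList]
  | cons a w ih => exact (ih _).trans (by simp)

/-- Popping symbols from `s` and pushing a word for each of them onto `t`, until `s` is empty. The
popped symbol is kept in the label `emit a`. -/
theorem transfer_reachesIn {m : Λ → TM2.Stmt Γ Λ σ} {s t : K} (hst : s ≠ t)
    (f : Γ s → List (Γ t)) {reg : Option (Γ s) → σ} {read : σ → Option (Γ s)}
    (read_reg : ∀ a, read (reg a) = a) {scan next : Λ} {emit : Γ s → Λ}
    (hscan : m scan = .pop s (fun _ a => reg a) (.goto fun v => (read v).elim next emit))
    (hemit : ∀ a, m (emit a) = pushList t (f a) (.goto fun _ => scan))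
    (v : σ) (S : ∀ k, List (Γ k)) :
    ReachesIn (TM2.step m) (2 * (S s).length + 1) ⟨some scan, v, S⟩
      ⟨some next, reg none, update (update S s []) t (((S s).flatMap f).reverse ++ S t)⟩ := by
  induction hw : S s generalizing v S with
  | nil =>
    have hS : update S s [] = S := by rw [← hw, update_eq_self]
    refine ReachesIn.single ?_
    simp [TM2.step, hscan, hw, read_reg, hS]
  | cons a w ih =>
    set S' := update (update S s w) t ((f a).reverse ++ S t) with hS'
    have hpop : TM2.step m ⟨some scan, v, S⟩ = some ⟨some (emit a), reg a, update S s w⟩ := by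
      simp [TM2.step, hscan, hw, read_reg]
    have hpush : TM2.step m ⟨some (emit a), reg a, update S s w⟩ = some ⟨some scan, reg a, S'⟩ := by
      simp [TM2.step, hemit, stepAux_pushList, hst.symm, hS']
    have hS : update (update S' s []) t ((w.flatMap f).reverse ++ S' t) =
        update (update S s []) t (((a :: w).flatMap f).reverse ++ S t) := by
      rw [hS', update_comm hst.symm, update_idem, update_idem, update_self]
      simp
    rw [← hS]
    exact ((ih (reg a) S' (by simp [hS', hst])).head hpush).head hpop

theorem transfer_reachesIn_update {m : Λ → TM2.Stmt Γ Λ σ} {s t : K} (hst : s ≠ t)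
    (f : Γ s → List (Γ t)) {reg : Option (Γ s) → σ} {read : σ → Option (Γ s)}
    (read_reg : ∀ a, read (reg a) = a) {scan next : Λ} {emit : Γ s → Λ}
    (hscan : m scan = .pop s (fun _ a => reg a) (.goto fun v => (read v).elim next emit))
    (hemit : ∀ a, m (emit a) = pushList t (f a) (.goto fun _ => scan)) (v : σ) (w : List (Γ s)) :
    ReachesIn (TM2.step m) (2 * w.length + 1) ⟨some scan, v, update (fun _ => []) s w⟩
      ⟨some next, reg none, update (fun _ => []) t (w.flatMap f).reverse⟩ := by
  simpa [hst.symm] using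
    transfer_reachesIn hst f read_reg hscan hemit v (update (fun _ => []) s w)

end Statements

section Embedding

variable {K K' : Type*} [DecidableEq K] [DecidableEq K'] {κ : K → K'} {Γ' : K' → Type*}
  {Λ Λ' σ σ' : Type*}

/-- An embedding of the stacks (along `κ`), labels and states of one stack machine into those of
another one, whose stacks outside the range of `κ` are kept fixed. The embedded machine goes on
to the label `exit`, if there is one, instead of halting. -/
structure MachineEmbedding (κ : K → K') (Γ' : K' → Type*) (Λ Λ' σ σ' : Type*) where
  label : Λ → Λ'
  exit : Option Λ'
  put : σ → σ'
  get : σ' → σ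
  get_put (v : σ) : get (put v) = v
  place : (∀ k, List (Γ' (κ k))) → ∀ k, List (Γ' k)
  place_apply (S : ∀ k, List (Γ' (κ k))) (k : K) : place S (κ k) = S k
  update_place (S : ∀ k, List (Γ' (κ k))) (k : K) (w : List (Γ' (κ k))) :
    update (place S) (κ k) w = place (update S k w)

namespace MachineEmbedding

variable (e : MachineEmbedding κ Γ' Λ Λ' σ σ')

/-- The translation of statements along an embedding. -/
def stmt : TM2.Stmt (fun k => Γ' (κ k)) Λ σ → TM2.Stmt Γ' Λ' σ'
  | .push k f q => .push (κ k) (fun s => f (e.get s)) (stmt q)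
  | .peek k f q => .peek (κ k) (fun s a => e.put (f (e.get s) a)) (stmt q)
  | .pop k f q => .pop (κ k) (fun s a => e.put (f (e.get s) a)) (stmt q)
  | .load f q => .load (fun s => e.put (f (e.get s))) (stmt q)
  | .branch f q₁ q₂ => .branch (fun s => f (e.get s)) (stmt q₁) (stmt q₂)
  | .goto f => .goto (fun s => e.label (f (e.get s)))
  | .halt => e.exit.elim .halt (fun l => .goto fun _ => l)

/-- The translation of configurations along an embedding. -/
def cfg (c : TM2.Cfg (fun k => Γ' (κ k)) Λ σ) : TM2.Cfg Γ' Λ' σ' :=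
  ⟨c.l.elim e.exit fun l => some (e.label l), e.put c.var, e.place c.stk⟩

theorem stepAux_stmt (q : TM2.Stmt (fun k => Γ' (κ k)) Λ σ) (v : σ)
    (S : ∀ k, List (Γ' (κ k))) :
    TM2.stepAux (e.stmt q) (e.put v) (e.place S) = e.cfg (TM2.stepAux q v S) := by
  induction q generalizing v S with
  | push k f q ih => simp [stmt, e.get_put, e.place_apply, e.update_place, ih]
  | peek k f q ih => simp [stmt, e.get_put, e.place_apply, ih]
  | pop k f q ih => simp [stmt, e.get_put, e.place_apply, e.update_place, ih]
  | load f q ih => simp [stmt, e.get_put, ih]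
  | branch f q₁ q₂ ih₁ ih₂ => cases h : f v <;> simp [stmt, e.get_put, h, ih₁, ih₂]
  | goto f => simp [stmt, cfg, e.get_put]
  | halt => cases h : e.exit <;> simp [stmt, cfg, h]

theorem reachesIn {m : Λ → TM2.Stmt (fun k => Γ' (κ k)) Λ σ} {m' : Λ' → TM2.Stmt Γ' Λ' σ'}
    (hm : ∀ l, m' (e.label l) = e.stmt (m l)) {n : ℕ} {c d : TM2.Cfg (fun k => Γ' (κ k)) Λ σ}
    (h : ReachesIn (TM2.step m) n c d) : ReachesIn (TM2.step m') n (e.cfg c) (e.cfg d) := by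
  refine h.map e.cfg fun c d hcd => ?_
  obtain ⟨_ | l, v, S⟩ := c
  · simp [TM2.step] at hcd
  · obtain rfl := Option.some.inj hcd
    rw [← stepAux_stmt, ← hm]
    rfl

end MachineEmbedding

end Embedding

/-- A bound for the number of symbols that a machine pushes in one step. -/
def maxPush (M : FinTM2) : ℕ :=
  letI := M.ΛFin
  ∑ l : M.Λ, pushCount (M.m l)

theorem length_step_le (M : FinTM2) (k : M.K) (a b : M.Cfg) (h : M.step a = some b) :
    (b.stk k).length ≤ (a.stk k).length + maxPush M := by
  let _ := M.ΛFin
  obtain ⟨_ | l, v, S⟩ := a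
  · simp [TM2.step] at h
  · obtain rfl := Option.some.inj h
    refine (length_stepAux_le _ _ _ _).trans (Nat.add_le_add_left ?_ _)
    exact Finset.single_le_sum (f := fun l => pushCount (M.m l)) (fun _ _ => Nat.zero_le _)
      (Finset.mem_univ l)

theorem length_output_le (M : FinTM2) {w : List (M.Γ M.k₀)} {w' : List (M.Γ M.k₁)} {t : ℕ}
    (h : ReachesIn M.step t (initList M w) (haltList M w')) :
    w'.length ≤ w.length + t * maxPush M := by
  have hle := h.measure_le (fun c => (c.stk M.k₁).length) (maxPush M) (length_step_le M M.k₁)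
  rw [initList_eq, haltList_eq] at hle
  refine le_trans (by simp) (hle.trans (Nat.add_le_add_right ?_ _))
  by_cases hk : M.k₁ = M.k₀
  · rw [hk]; simp
  · simp [hk]

/-! ### Polynomial-time computability -/

/-- The function `f` is computable in polynomial time by a multi-stack Turing machine, arguments and
values being encoded by `ea` and `eb`. -/
def PolyTimeComputable {α β αΓ βΓ : Type} (ea : α → List αΓ) (eb : β → List βΓ) (f : α → β) :
    Prop :=
  Nonempty (TM2ComputableInPolyTime ea eb f)

theorem polyTimeComputable_of_reachesIn (M : FinTM2)
    (f : List (M.Γ M.k₀) → List (M.Γ M.k₁)) (p : Polynomial ℕ)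
    (h : ∀ w, ∃ t ≤ p.eval w.length, ReachesIn (TM2.step M.m) t
      ⟨some M.main, M.initialState, update (fun _ => []) M.k₀ w⟩
      ⟨none, M.initialState, update (fun _ => []) M.k₁ (f w)⟩) :
    PolyTimeComputable id id f := by
  choose t ht hrun using h
  refine ⟨⟨⟨M, .refl _, .refl _⟩, p, fun w => ⟨⟨t w, ?_⟩, ht w⟩⟩⟩
  have h := hrun w
  rw [← initList_eq, ← haltList_eq] at h
  exact (List.map_id w).symm ▸ (List.map_id (f w)).symm ▸ h

/-- The labels of the program that carries a word over `Γ₁` to a stack with alphabet `Γ₂`, through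
an auxiliary stack. -/
inductive TransferLabel (Γ₁ Γ₂ : Type) : Type
  | unload | stash (a : Γ₁) | reload | feed (a : Γ₂)
  deriving Fintype

namespace Composition

variable (M₁ M₂ : FinTM2)

/-- The stack alphabets of the composition of two machines: those of the machines, and that of an
auxiliary stack `Sum.inr none`. -/
abbrev Alphabet : M₁.K ⊕ Option M₂.K → Type
  | .inl k => M₁.Γ k
  | .inr none => M₂.Γ M₂.k₀
  | .inr (some k) => M₂.Γ k

/-- The labels of the composed machine: the first program, the transfer of its output, and the
second program. -/
abbrev Label : Type := M₁.Λ ⊕ TransferLabel (M₁.Γ M₁.k₁) (M₂.Γ M₂.k₀) ⊕ M₂.Λ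

/-- The states of the composed machine: those of the two machines, and the symbols being moved. -/
abbrev State : Type := M₁.σ × M₂.σ × Option (M₁.Γ M₁.k₁) × Option (M₂.Γ M₂.k₀)

variable {M₁ M₂}

/-- The contents of all stacks of the composed machine when the auxiliary stack is empty. -/
def joinStacks (S₁ : ∀ k, List (M₁.Γ k)) (S₂ : ∀ k, List (M₂.Γ k)) :
    ∀ k, List (Alphabet M₁ M₂ k)
  | .inl k => S₁ k
  | .inr none => []
  | .inr (some k) => S₂ k

theorem joinStacks_nil :
    joinStacks (M₁ := M₁) (M₂ := M₂) (fun _ => []) (fun _ => []) = fun _ => [] := by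
  ext (k | _ | k) : 1 <;> rfl

theorem update_joinStacks_inl (S₁ : ∀ k, List (M₁.Γ k)) (S₂ : ∀ k, List (M₂.Γ k)) (k : M₁.K)
    (w : List (M₁.Γ k)) :
    update (joinStacks S₁ S₂) (.inl k) w = joinStacks (update S₁ k w) S₂ := by
  ext (j | _ | j) : 1
  · obtain rfl | h := eq_or_ne j k
    · simp [joinStacks]
    · simp [joinStacks, h]
  · rfl
  · rfl

theorem update_joinStacks_inr (S₁ : ∀ k, List (M₁.Γ k)) (S₂ : ∀ k, List (M₂.Γ k)) (k : M₂.K)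
    (w : List (M₂.Γ k)) :
    update (joinStacks S₁ S₂) (.inr (some k)) w = joinStacks S₁ (update S₂ k w) := by
  ext (j | _ | j) : 1
  · rfl
  · rfl
  · obtain rfl | h := eq_or_ne j k
    · simp [joinStacks]
    · simp [joinStacks, h]

theorem joinStacks_update_inl (k : M₁.K) (w : List (M₁.Γ k)) :
    joinStacks (update (fun _ => []) k w) (fun _ => []) =
      update (fun _ => [] : ∀ k, List (Alphabet M₁ M₂ k)) (.inl k) w := by
  rw [← update_joinStacks_inl, joinStacks_nil]

theorem joinStacks_update_inr (k : M₂.K) (w : List (M₂.Γ k)) :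
    joinStacks (fun _ => []) (update (fun _ => []) k w) =
      update (fun _ => [] : ∀ k, List (Alphabet M₁ M₂ k)) (.inr (some k)) w := by
  rw [← update_joinStacks_inr, joinStacks_nil]

variable (M₁ M₂) in
/-- The embedding of the first machine, at whose end the transfer begins. -/
def left : MachineEmbedding Sum.inl (Alphabet M₁ M₂) M₁.Λ (Label M₁ M₂) M₁.σ (State M₁ M₂) where
  label := .inl
  exit := some (.inr (.inl .unload))
  put v := (v, M₂.initialState, none, none)
  get v := v.1
  get_put _ := rfl
  place S := joinStacks S (fun _ => [])
  place_apply _ _ := rfl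
  update_place _ _ _ := update_joinStacks_inl _ _ _ _

variable (M₁ M₂) in
/-- The embedding of the second machine. -/
def right : MachineEmbedding (fun k => Sum.inr (some k)) (Alphabet M₁ M₂) M₂.Λ (Label M₁ M₂) M₂.σ
    (State M₁ M₂) where
  label l := .inr (.inr l)
  exit := none
  put v := (M₁.initialState, v, none, none)
  get v := v.2.1
  get_put _ := rfl
  place S := joinStacks (fun _ => []) S
  place_apply _ _ := rfl
  update_place _ _ _ := update_joinStacks_inr _ _ _ _

variable (e : M₁.Γ M₁.k₁ ≃ M₂.Γ M₂.k₀)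

/-- The program of the composed machine. -/
def program : Label M₁ M₂ → TM2.Stmt (Alphabet M₁ M₂) (Label M₁ M₂) (State M₁ M₂)
  | .inl l => (left M₁ M₂).stmt (M₁.m l)
  | .inr (.inl .unload) =>
    .pop (.inl M₁.k₁) (fun _ a => (M₁.initialState, M₂.initialState, a, none))
      (.goto fun v => v.2.2.1.elim (.inr (.inl .reload)) fun a => .inr (.inl (.stash a)))
  | .inr (.inl (.stash a)) => pushList (.inr none) [e a] (.goto fun _ => .inr (.inl .unload))
  | .inr (.inl .reload) =>
    .pop (.inr none) (fun _ a => (M₁.initialState, M₂.initialState, none, a))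
      (.goto fun v => v.2.2.2.elim (.inr (.inr M₂.main)) fun a => .inr (.inl (.feed a)))
  | .inr (.inl (.feed a)) =>
    pushList (.inr (some M₂.k₀)) [a] (.goto fun _ => .inr (.inl .reload))
  | .inr (.inr l) => (right M₁ M₂).stmt (M₂.m l)

/-- The machine that runs `M₁`, moves its output to the input stack of `M₂`, translating symbols
along `e`, and runs `M₂`. -/
def machine : FinTM2 :=
  letI := M₁.kFin
  letI := M₂.kFin
  letI := M₁.ΛFin
  letI := M₂.ΛFin
  letI := M₁.σFin
  letI := M₂.σFin
  letI := M₂.Γk₀Fin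
  letI := Fintype.ofEquiv _ e.symm
  { K := M₁.K ⊕ Option M₂.K
    k₀ := .inl M₁.k₀
    k₁ := .inr (some M₂.k₁)
    Γ := Alphabet M₁ M₂
    Λ := Label M₁ M₂
    main := .inl M₁.main
    σ := State M₁ M₂
    initialState := (M₁.initialState, M₂.initialState, none, none)
    Γk₀Fin := M₁.Γk₀Fin
    m := program e }

theorem left_cfg_initList (w : List (M₁.Γ M₁.k₀)) :
    (left M₁ M₂).cfg (initList M₁ w) = initList (machine e) w := by
  refine (congrArg (left M₁ M₂).cfg (initList_eq M₁ w)).trans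
    (Eq.trans (congrArg (TM2.Cfg.mk _ _) ?_) (initList_eq (machine e) w).symm)
  exact joinStacks_update_inl M₁.k₀ w

theorem right_cfg_haltList (w : List (M₂.Γ M₂.k₁)) :
    (right M₁ M₂).cfg (haltList M₂ w) = haltList (machine e) w := by
  refine (congrArg (right M₁ M₂).cfg (haltList_eq M₂ w)).trans
    (Eq.trans (congrArg (TM2.Cfg.mk _ _) ?_) (haltList_eq (machine e) w).symm)
  exact joinStacks_update_inr M₂.k₁ w

theorem transfer_reachesIn_machine (w : List (M₁.Γ M₁.k₁)) :
    ReachesIn (machine e).step (4 * w.length + 2) ((left M₁ M₂).cfg (haltList M₁ w))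
      ((right M₁ M₂).cfg (initList M₂ (w.map e))) := by
  have hleft : (left M₁ M₂).cfg (haltList M₁ w) =
      ⟨some (.inr (.inl .unload)), (M₁.initialState, M₂.initialState, none, none),
        update (fun _ => []) (.inl M₁.k₁) w⟩ :=
    (congrArg (left M₁ M₂).cfg (haltList_eq M₁ w)).trans
      (congrArg (TM2.Cfg.mk _ _) (joinStacks_update_inl M₁.k₁ w))
  have hright : (right M₁ M₂).cfg (initList M₂ (w.map e)) =
      ⟨some (.inr (.inr M₂.main)), (M₁.initialState, M₂.initialState, none, none),
        update (fun _ => []) (.inr (some M₂.k₀)) (w.map e)⟩ :=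
    (congrArg (right M₁ M₂).cfg (initList_eq M₂ (w.map e))).trans
      (congrArg (TM2.Cfg.mk _ _) (joinStacks_update_inr M₂.k₀ (w.map e)))
  have hunload := transfer_reachesIn_update (m := program e) (s := .inl M₁.k₁) (t := .inr none)
    (by simp) (fun a => [e a])
    (reg := fun a => (M₁.initialState, M₂.initialState, a, none)) (read := fun v => v.2.2.1)
    (fun _ => rfl) (scan := .inr (.inl .unload)) rfl (fun _ => rfl)
    (M₁.initialState, M₂.initialState, none, none) w
  have hreload := transfer_reachesIn_update (m := program e) (s := .inr none)
    (t := .inr (some M₂.k₀)) (by simp) (fun a => [a])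
    (reg := fun a => (M₁.initialState, M₂.initialState, none, a)) (read := fun v => v.2.2.2)
    (fun _ => rfl) (scan := .inr (.inl .reload)) rfl (fun _ => rfl)
    (M₁.initialState, M₂.initialState, none, none) (w.map e).reverse
  simp only [← List.map_eq_flatMap, List.length_reverse, List.length_map, List.map_id',
    List.reverse_reverse] at hunload hreload
  rw [hleft, hright, show 4 * w.length + 2 = (2 * w.length + 1) + (2 * w.length + 1) by ring]
  exact hunload.trans hreload

theorem machine_reachesIn {t₁ t₂ : ℕ} {w₁ : List (M₁.Γ M₁.k₀)} {w : List (M₁.Γ M₁.k₁)}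
    {w₂ : List (M₂.Γ M₂.k₁)} (h₁ : ReachesIn M₁.step t₁ (initList M₁ w₁) (haltList M₁ w))
    (h₂ : ReachesIn M₂.step t₂ (initList M₂ (w.map e)) (haltList M₂ w₂)) :
    ReachesIn (machine e).step (t₁ + (4 * w.length + 2) + t₂) (initList (machine e) w₁)
      (haltList (machine e) w₂) := by
  rw [← left_cfg_initList, ← right_cfg_haltList]
  exact (((left M₁ M₂).reachesIn (fun _ => rfl) h₁).trans (transfer_reachesIn_machine e w)).trans
    ((right M₁ M₂).reachesIn (fun _ => rfl) h₂)

end Composition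

theorem monotone_polynomial_eval (p : Polynomial ℕ) : Monotone fun n => p.eval n := by
  intro m n hmn
  simp only [Polynomial.eval_eq_sum_range]
  gcongr

theorem PolyTimeComputable.comp {α β γ αΓ βΓ γΓ : Type} {ea : α → List αΓ} {eb : β → List βΓ}
    {ec : γ → List γΓ} {f : α → β} {g : β → γ} (hg : PolyTimeComputable eb ec g)
    (hf : PolyTimeComputable ea eb f) : PolyTimeComputable ea ec (g ∘ f) := by
  obtain ⟨⟨⟨M₁, i₁, o₁⟩, p₁, run₁⟩⟩ := hf
  obtain ⟨⟨⟨M₂, i₂, o₂⟩, p₂, run₂⟩⟩ := hg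
  let q : Polynomial ℕ := .X + p₁ * .C (maxPush M₁)
  refine ⟨⟨⟨Composition.machine (o₁.trans i₂.symm), i₁, o₂⟩, p₁ + (4 * q + 2) + p₂.comp q,
    fun a => ?_⟩⟩
  obtain ⟨⟨t₁, h₁⟩, ht₁⟩ := run₁ a
  obtain ⟨⟨t₂, h₂⟩, ht₂⟩ := run₂ (f a)
  have hlen : (eb (f a)).length ≤ q.eval (ea a).length := by
    have hout := length_output_le M₁ h₁
    simp only [List.length_map] at hout
    simp only [q, Polynomial.eval_add, Polynomial.eval_X, Polynomial.eval_mul, Polynomial.eval_C]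
    exact hout.trans (by gcongr)
  have hmid : ((eb (f a)).map o₁.invFun).map (o₁.trans i₂.symm) = (eb (f a)).map i₂.invFun := by
    simp
  refine ⟨⟨_, Composition.machine_reachesIn (o₁.trans i₂.symm) h₁ (hmid ▸ h₂)⟩, ?_⟩
  have ht₂' : t₂ ≤ p₂.eval (q.eval (ea a).length) :=
    ht₂.trans (monotone_polynomial_eval p₂ hlen)
  simp only [List.length_map, Polynomial.eval_add, Polynomial.eval_comp, Polynomial.eval_mul,
    Polynomial.eval_ofNat]
  gcongr

theorem PolyTimeComputable.iff_encode_comp {α β αΓ βΓ : Type} {ea : α → List αΓ}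
    {eb : β → List βΓ} {f : α → β} :
    PolyTimeComputable ea eb f ↔ PolyTimeComputable ea id (eb ∘ f) :=
  ⟨fun ⟨⟨M, p, h⟩⟩ => ⟨⟨M, p, h⟩⟩, fun ⟨⟨M, p, h⟩⟩ => ⟨⟨M, p, h⟩⟩⟩

section FlatMap

variable {α β : Type}

/-- The stacks of the machine that applies a letterwise substitution. -/
inductive FlatMapStack : Type
  | input | buffer | output
  deriving DecidableEq

instance : Fintype FlatMapStack :=
  ⟨{.input, .buffer, .output}, fun k => by cases k <;> decide⟩

/-- The stack alphabets of the machine that applies a letterwise substitution. -/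
abbrev FlatMapStack.Alphabet (α β : Type) : FlatMapStack → Type
  | .input => α
  | .buffer => β
  | .output => β

/-- The labels of the machine that applies a letterwise substitution. -/
inductive FlatMapLabel (α β : Type) : Type
  | scan | emit (a : α) | append | unspool | feed (b : β) | done
  deriving Fintype

variable (h : α → List β) (l : List β)

/-- A program that replaces each symbol `a` of its input by the word `h a`, and appends the word
`l`. -/
def flatMapProgram :
    FlatMapLabel α β →
      TM2.Stmt (FlatMapStack.Alphabet α β) (FlatMapLabel α β) (Option α × Option β)
  | .scan => .pop .input (fun _ a => (a, none)) (.goto fun v => v.1.elim .append .emit)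
  | .emit a => pushList .buffer (h a) (.goto fun _ => .scan)
  | .append => pushList .buffer l (.goto fun _ => .unspool)
  | .unspool => .pop .buffer (fun _ b => (none, b)) (.goto fun v => v.2.elim .done .feed)
  | .feed b => pushList .output [b] (.goto fun _ => .unspool)
  | .done => .halt

theorem flatMapProgram_reachesIn (w : List α) :
    ReachesIn (TM2.step (flatMapProgram h l))
      ((2 * w.length + 1) + 1 + (2 * (w.flatMap h ++ l).length + 1) + 1)
      ⟨some .scan, (none, none), update (fun _ => []) .input w⟩
      ⟨none, (none, none), update (fun _ => []) .output (w.flatMap h ++ l)⟩ := by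
  have hscan := transfer_reachesIn_update (m := flatMapProgram h l) (s := .input)
    (t := .buffer) (by simp) h (reg := fun a => (a, none)) (read := Prod.fst) (fun _ => rfl)
    (scan := .scan) rfl (fun _ => rfl) (none, none) w
  have happend : ReachesIn (TM2.step (flatMapProgram h l)) 1
      ⟨some .append, (none, none), update (fun _ => []) .buffer (w.flatMap h).reverse⟩
      ⟨some .unspool, (none, none), update (fun _ => []) .buffer (w.flatMap h ++ l).reverse⟩ := by
    refine ReachesIn.single ((congrArg some (stepAux_pushList _ _ _ _ _)).trans ?_)
    simp
  have hunspool := transfer_reachesIn_update (m := flatMapProgram h l) (s := .buffer)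
    (t := .output) (by simp) (fun b => [b]) (reg := fun b => (none, b)) (read := Prod.snd)
    (fun _ => rfl) (scan := .unspool) rfl (fun _ => rfl) (none, none) (w.flatMap h ++ l).reverse
  have hdone : ReachesIn (TM2.step (flatMapProgram h l)) 1
      ⟨some .done, (none, none), update (fun _ => []) .output (w.flatMap h ++ l)⟩
      ⟨none, (none, none), update (fun _ => []) .output (w.flatMap h ++ l)⟩ := rfl
  simp only [← List.map_eq_flatMap, List.length_reverse, List.map_id',
    List.reverse_reverse] at hunspool
  exact ((hscan.trans happend).trans hunspool).trans hdone

theorem length_flatMap_le [Fintype α] (w : List α) :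
    (w.flatMap h).length ≤ w.length * ∑ a, (h a).length := by
  rw [List.length_flatMap, ← List.length_map (fun a => (h a).length), ← smul_eq_mul]
  refine List.sum_le_card_nsmul _ _ fun k hk => ?_
  obtain ⟨a, -, rfl⟩ := List.mem_map.1 hk
  exact Finset.single_le_sum (f := fun a => (h a).length) (fun _ _ => Nat.zero_le _)
    (Finset.mem_univ a)

theorem polyTimeComputable_flatMap_append [Finite α] [Finite β] :
    PolyTimeComputable id id fun w : List α => w.flatMap h ++ l := by
  have := Fintype.ofFinite α
  have := Fintype.ofFinite β
  let M : FinTM2 :=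
    { K := FlatMapStack
      k₀ := .input
      k₁ := .output
      Γ := FlatMapStack.Alphabet α β
      Λ := FlatMapLabel α β
      main := .scan
      σ := Option α × Option β
      initialState := (none, none)
      Γk₀Fin := inferInstanceAs (Fintype α)
      m := flatMapProgram h l }
  refine polyTimeComputable_of_reachesIn M _
    (2 * .X + 2 * (.X * .C (∑ a, (h a).length) + .C l.length) + 4) fun w =>
      ⟨_, ?_, flatMapProgram_reachesIn h l w⟩
  have hlen := length_flatMap_le h w
  simp only [List.length_append, Polynomial.eval_add, Polynomial.eval_mul, Polynomial.eval_ofNat,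
    Polynomial.eval_X, Polynomial.eval_C]
  omega

end FlatMap

section CopyPrefix

theorem exists_eq_replicate_append {α : Type*} (u : α) (w : List α) :
    ∃ m w', w'.head? ≠ some u ∧ w = List.replicate m u ++ w' := by
  induction w with
  | nil => exact ⟨0, [], by simp⟩
  | cons a w ih =>
    obtain rfl | ha := eq_or_ne a u
    · obtain ⟨m, w', hw', hw⟩ := ih
      exact ⟨m + 1, w', hw', by rw [hw]; rfl⟩
    · exact ⟨0, a :: w, by simpa using ha, rfl⟩

variable {α : Type} [DecidableEq α] (u : α) (l₁ l₂ : List α)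

/-- The word `w`, with a copy of the longest prefix of the form `uᵐ` inserted after this prefix,
between the words `l₁` and `l₂`. -/
def copyPrefix (w : List α) : List α :=
  w.takeWhile (· = u) ++ l₁ ++ w.takeWhile (· = u) ++ l₂ ++ w.dropWhile (· = u)

theorem copyPrefix_replicate_append (m : ℕ) {w : List α} (hw : w.head? ≠ some u) :
    copyPrefix u l₁ l₂ (List.replicate m u ++ w) =
      List.replicate m u ++ (l₁ ++ (List.replicate m u ++ (l₂ ++ w))) := by
  have htake : w.takeWhile (· = u) = [] := by cases w <;> simp_all
  have hdrop : w.dropWhile (· = u) = w := by cases w <;> simp_all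
  simp [copyPrefix, List.takeWhile_append_of_pos, List.dropWhile_append_of_pos, htake, hdrop]

/-- The stacks of the machine that computes `copyPrefix`. -/
inductive CopyPrefixStack : Type
  | word | counter | spare
  deriving DecidableEq

instance : Fintype CopyPrefixStack :=
  ⟨{.word, .counter, .spare}, fun k => by cases k <;> decide⟩

/-- The labels of the machine that computes `copyPrefix`. -/
inductive CopyPrefixLabel : Type
  | count | refill | unspool
  deriving DecidableEq

instance : Fintype CopyPrefixLabel :=
  ⟨{.count, .refill, .unspool}, fun k => by cases k <;> decide⟩

/-- A program that computes `copyPrefix`: it moves the prefix from its input stack to a counter,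
restores it while copying the counter, and restores it again. -/
def copyPrefixProgram :
    CopyPrefixLabel → TM2.Stmt (fun _ : CopyPrefixStack => α) CopyPrefixLabel (Option α)
  | .count => .peek .word (fun _ a => a) <| .branch (fun v => v = some u)
      (.pop .word (fun _ a => a) <| .push .counter (fun _ => u) <| .goto fun _ => .count)
      (pushList .word l₂.reverse <| .goto fun _ => .refill)
  | .refill => .pop .counter (fun _ a => a) <| .branch (fun v => v.isSome)
      (.push .word (fun _ => u) <| .push .spare (fun _ => u) <| .goto fun _ => .refill)
      (pushList .word l₁.reverse <| .goto fun _ => .unspool)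
  | .unspool => .pop .spare (fun _ a => a) <| .branch (fun v => v.isSome)
      (.push .word (fun _ => u) <| .goto fun _ => .unspool)
      .halt

namespace CopyPrefixStack

/-- The contents of all stacks of the machine that computes `copyPrefix`. -/
def contents {α : Type} (W C D : List α) : CopyPrefixStack → List α
  | .word => W
  | .counter => C
  | .spare => D

section
variable {α : Type} (W C D X : List α)

theorem contents_nil_nil : contents W [] [] = update (fun _ => []) .word W := by
  ext (_ | _ | _) : 1 <;> rfl

theorem update_word : update (contents W C D) .word X = contents X C D := by
  ext (_ | _ | _) : 1 <;> rfl

theorem update_counter : update (contents W C D) .counter X = contents W X D := by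
  ext (_ | _ | _) : 1 <;> rfl

theorem update_spare : update (contents W C D) .spare X = contents W C X := by
  ext (_ | _ | _) : 1 <;> rfl
end

end CopyPrefixStack

open CopyPrefixStack

theorem replicate_append_cons {α : Type*} (m : ℕ) (a : α) (w : List α) :
    List.replicate m a ++ a :: w = List.replicate (m + 1) a ++ w := by
  rw [List.replicate_succ', List.append_assoc, List.singleton_append]

theorem reachesIn_count (m : ℕ) {w : List α} (hw : w.head? ≠ some u) (C D : List α)
    (v : Option α) :
    ReachesIn (TM2.step (copyPrefixProgram u l₁ l₂)) (m + 1)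
      ⟨some .count, v, contents (List.replicate m u ++ w) C D⟩
      ⟨some .refill, w.head?, contents (l₂ ++ w) (List.replicate m u ++ C) D⟩ := by
  induction m generalizing C v with
  | zero =>
    refine ReachesIn.single ?_
    simp [TM2.step, copyPrefixProgram, contents, hw, stepAux_pushList, update_word]
  | succ m ih =>
    have hrest := ih (u :: C) (some u)
    rw [replicate_append_cons] at hrest
    refine hrest.head ?_
    simp [TM2.step, copyPrefixProgram, contents, update_word, update_counter,
      List.replicate_succ]

theorem reachesIn_refill (m : ℕ) (W D : List α) (v : Option α) :
    ReachesIn (TM2.step (copyPrefixProgram u l₁ l₂)) (m + 1)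
      ⟨some .refill, v, contents W (List.replicate m u) D⟩
      ⟨some .unspool, none,
        contents (l₁ ++ (List.replicate m u ++ W)) [] (List.replicate m u ++ D)⟩ := by
  induction m generalizing W D v with
  | zero =>
    refine ReachesIn.single ?_
    simp [TM2.step, copyPrefixProgram, contents, stepAux_pushList, update_word, update_counter]
  | succ m ih =>
    have hrest := ih (u :: W) (u :: D) (some u)
    rw [replicate_append_cons, replicate_append_cons] at hrest
    refine hrest.head ?_
    simp [TM2.step, copyPrefixProgram, contents, update_word, update_counter, update_spare,
      List.replicate_succ]

theorem reachesIn_unspool (m : ℕ) (W : List α) (v : Option α) :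
    ReachesIn (TM2.step (copyPrefixProgram u l₁ l₂)) (m + 1)
      ⟨some .unspool, v, contents W [] (List.replicate m u)⟩
      ⟨none, none, contents (List.replicate m u ++ W) [] []⟩ := by
  induction m generalizing W v with
  | zero =>
    refine ReachesIn.single ?_
    simp [TM2.step, copyPrefixProgram, contents, update_spare]
  | succ m ih =>
    have hrest := ih (u :: W) (some u)
    rw [replicate_append_cons] at hrest
    refine hrest.head ?_
    simp [TM2.step, copyPrefixProgram, contents, update_word, update_spare, List.replicate_succ]

theorem polyTimeComputable_copyPrefix [Finite α] :
    PolyTimeComputable id id (copyPrefix u l₁ l₂) := by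
  have := Fintype.ofFinite α
  let M : FinTM2 :=
    { K := CopyPrefixStack
      k₀ := .word
      k₁ := .word
      Γ _ := α
      Λ := CopyPrefixLabel
      main := .count
      σ := Option α
      initialState := none
      m := copyPrefixProgram u l₁ l₂ }
  refine polyTimeComputable_of_reachesIn M _ (3 * .X + 3) fun w => ?_
  obtain ⟨m, w, hw, rfl⟩ := exists_eq_replicate_append u w
  refine ⟨(m + 1) + (m + 1) + (m + 1), ?_, ?_⟩
  · simp only [List.length_append, List.length_replicate, Polynomial.eval_add,
      Polynomial.eval_mul, Polynomial.eval_ofNat, Polynomial.eval_X]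
    omega
  have hcount := reachesIn_count u l₁ l₂ m hw [] [] none
  rw [List.append_nil] at hcount
  have hrefill := reachesIn_refill u l₁ l₂ m (l₂ ++ w) [] w.head?
  rw [List.append_nil] at hrefill
  have hunspool := reachesIn_unspool u l₁ l₂ m (l₁ ++ (List.replicate m u ++ (l₂ ++ w))) none
  rw [← copyPrefix_replicate_append u l₁ l₂ m hw] at hunspool
  rw [contents_nil_nil] at hcount hunspool
  exact (hcount.trans hrefill).trans hunspool

end CopyPrefix

/-! ### Computations that are active with small probability -/

variable {n : ℕ}

/-- A gate without controls. -/
def Gate.single (k : Kind) (i : Fin n) : Gate n := ⟨k, i, [], by simp⟩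

/-- A NOT gate with one control. -/
def Gate.cnot (target control : Fin n) (h : target ≠ control) : Gate n :=
  ⟨.flip, target, [control], by simpa using h⟩

/-- A gate on the last `n` qubits of a register of `n + 1` qubits, with the first qubit as an
additional control. -/
def Gate.controlled (g : Gate n) : Gate (n + 1) where
  kind := g.kind
  target := g.target.succ
  controls := g.controls.map Fin.succ ++ [0]
  distinct := by
    have h := g.distinct.map (Fin.succ_injective n)
    rw [List.map_cons] at h
    rw [← List.cons_append, List.nodup_append]
    exact ⟨h, List.nodup_singleton _, by simp [Fin.succ_ne_zero]⟩

/-- The qubit of a circuit that is measured. -/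
def Circuit.first (C : Circuit) : Fin C.n := ⟨0, C.pos⟩

/-- The gates of `C`, between a phase gate, which has no effect on the input state, and a NOT gate
on the measured qubit. The phase gate is there because the descriptions of controlled gates are
easy to produce in the context of a preceding gate, see `Gate.control_cons_encode_controlled`. -/
def Circuit.body (C : Circuit) : List (Gate C.n) :=
  Gate.single .phase C.first :: C.gates ++ [Gate.single .flip C.first]

/-- The computation of `C`, controlled by a new first qubit which is put into the state `|1⟩` with
probability `1 / (C.n + 1) ^ b`. The controlled NOT gate at the end of the controlled computation
and the last gate write the conjunction of the control qubit and the measured qubit of `C` onto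
the control qubit. -/
def Circuit.weaken (b : ℕ) (C : Circuit) : Circuit where
  n := C.n + 1
  pos := Nat.succ_pos _
  gates := .single (.rot C.n b) 0 ::
    C.body.map Gate.controlled ++ [.cnot 0 C.first.succ (Fin.succ_ne_zero _).symm]

theorem Gate.IsBasic.arity_le_two {g : Gate n} (h : g.IsBasic) : g.arity ≤ 2 := by
  rcases h with h | h | h <;> omega

theorem Gate.arity_controlled (g : Gate n) : g.controlled.arity = g.arity + 1 := by
  simp [Gate.arity, Gate.controlled]

theorem Circuit.arity_body_le {C : Circuit} {d : ℕ} (hd : 1 ≤ d)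
    (hC : ∀ g ∈ C.gates, g.arity ≤ d) : ∀ g ∈ C.body, g.arity ≤ d := by
  have hsingle (k : Kind) : (Gate.single k C.first).arity ≤ d := hd
  simpa [Circuit.body, or_imp, forall_and, hsingle] using hC

theorem Circuit.arity_weaken_le {C : Circuit} {d : ℕ} (hd : 1 ≤ d)
    (hC : ∀ g ∈ C.gates, g.arity ≤ d) (b : ℕ) : ∀ g ∈ (C.weaken b).gates, g.arity ≤ d + 1 := by
  have hcontrolled : ∀ g ∈ C.body.map Gate.controlled, g.arity ≤ d + 1 := by
    intro g hg
    obtain ⟨g, hgC, rfl⟩ := List.mem_map.1 hg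
    exact g.arity_controlled.trans_le (Nat.succ_le_succ (arity_body_le hd hC g hgC))
  refine List.forall_mem_append.2 ⟨List.forall_mem_cons.2 ⟨?_, hcontrolled⟩,
    List.forall_mem_singleton.2 ?_⟩
  · exact Nat.succ_le_succ (Nat.zero_le d)
  · exact Nat.succ_le_succ hd

/-! ### Uniformity of the weakened circuits -/

/-- The substitution of symbols that turns the description of a gate into that of the controlled
gate, up to the symbol for the new control, which comes before the description instead of after
it. -/
def controlledSym : Sym → List Sym
  | .had => [.control, .had]
  | .phase => [.control, .phase]
  | .flip => [.control, .flip]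
  | .rot => [.control, .rot]
  | .target => [.target, .one]
  | .control => [.control, .one]
  | s => [s]

theorem unary_zero : unary 0 = [] := rfl

theorem unary_succ (k : ℕ) : unary (k + 1) = .one :: unary k := rfl

theorem flatMap_controlledSym_unary (k : ℕ) : (unary k).flatMap controlledSym = unary k := by
  induction k with
  | zero => rfl
  | succ k ih => exact congrArg (Sym.one :: ·) ih

theorem Kind.flatMap_controlledSym_encode (k : Kind) :
    k.encode.flatMap controlledSym = .control :: k.encode := by
  cases k <;> simp [Kind.encode, controlledSym, flatMap_controlledSym_unary]

-- In `Gate.encode` the list of controls is coerced to `List ℕ` by the monad structure of `List`.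
theorem Gate.encode_eq (g : Gate n) :
    g.encode = g.kind.encode ++ .target :: unary g.target ++
      g.controls.flatMap fun c : Fin n => .control :: unary c := by
  simp [Gate.encode, List.flatMap_assoc]

theorem Gate.control_cons_encode_controlled (g : Gate n) :
    .control :: g.controlled.encode = g.encode.flatMap controlledSym ++ [.control] := by
  simp [Gate.encode_eq, Gate.controlled, List.flatMap_map, List.flatMap_assoc, controlledSym,
    Kind.flatMap_controlledSym_encode, flatMap_controlledSym_unary,
    unary_zero, unary_succ]

theorem control_cons_flatMap_encode_controlled (l : List (Gate n)) :
    .control :: (l.map Gate.controlled).flatMap Gate.encode =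
      (l.flatMap Gate.encode).flatMap controlledSym ++ [.control] := by
  induction l with
  | nil => rfl
  | cons g l ih =>
    rw [List.map_cons, List.flatMap_cons, List.flatMap_cons, List.flatMap_append,
      ← List.cons_append, g.control_cons_encode_controlled, List.append_assoc, List.append_assoc,
      ← ih, List.singleton_append]

theorem head?_flatMap_encode_append (l : List (Gate n)) {w : List Sym} (hw : w.head? ≠ some .one) :
    ((l.flatMap Gate.encode).flatMap controlledSym ++ w).head? ≠ some .one := by
  cases l with
  | nil => exact hw
  | cons g l => cases h : g.kind <;> simp [Gate.encode, h, Kind.encode, controlledSym]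

theorem Circuit.encode_weaken (b : ℕ) (C : Circuit) :
    (C.weaken b).encode =
      copyPrefix .one [.one, .rot] (.exponent :: unary b ++ [.target, .phase, .target, .one])
        (C.encode.flatMap controlledSym ++
          [.control, .flip, .target, .one, .control, .flip, .target, .control, .one]) := by
  have hbody : (C.body.map Gate.controlled).flatMap Gate.encode =
      [.phase, .target, .one] ++ ((C.gates.flatMap Gate.encode).flatMap controlledSym ++
        [.control, .flip, .target, .one, .control]) := by
    refine List.cons_injective ((control_cons_flatMap_encode_controlled C.body).trans ?_)
    simp [Circuit.body, Circuit.first, Gate.single, Gate.encode, Kind.encode, controlledSym, unary]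
  have hsplit : C.encode.flatMap controlledSym = List.replicate C.n .one ++
      (C.gates.flatMap Gate.encode).flatMap controlledSym := by
    rw [Circuit.encode, List.flatMap_append, flatMap_controlledSym_unary, unary]
  rw [hsplit, List.append_assoc, copyPrefix_replicate_append _ _ _ _
    (head?_flatMap_encode_append _ (by simp)), Circuit.encode]
  simp only [Circuit.weaken, List.cons_append, List.flatMap_cons, List.flatMap_append, hbody]
  simp [Circuit.first, Gate.single, Gate.cnot, Gate.encode, Kind.encode, unary,
    List.replicate_succ']

instance : Fintype Sym :=
  ⟨{.one, .had, .phase, .flip, .rot, .exponent, .target, .control}, fun s => by cases s <;> decide⟩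

theorem PolyTimeUniform.weaken {F : List Bool → Circuit} (hF : PolyTimeUniform F) (b : ℕ) :
    PolyTimeUniform fun x => (F x).weaken b := by
  have hencode := PolyTimeComputable.iff_encode_comp.1 hF
  refine PolyTimeComputable.iff_encode_comp.2 ?_
  rw [show (Circuit.encode ∘ fun x => (F x).weaken b) = _ from
    funext fun x => (F x).encode_weaken b]
  exact (polyTimeComputable_copyPrefix _ _ _).comp
    ((polyTimeComputable_flatMap_append controlledSym _).comp hencode)

/-! ### Unitarity of the evolution -/

theorem sum_norm_sq_mulVec {ι : Type*} [Fintype ι] [DecidableEq ι] {U : Matrix ι ι ℂ}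
    (hU : U ∈ Matrix.unitaryGroup ι ℂ) (v : ι → ℂ) :
    ∑ i, ‖(U.mulVec v) i‖ ^ 2 = ∑ i, ‖v i‖ ^ 2 := by
  have hsq (w : ι → ℂ) : ((∑ i, ‖w i‖ ^ 2 : ℝ) : ℂ) = star w ⬝ᵥ w := by
    simp [dotProduct, Complex.conj_mul']
  apply Complex.ofReal_injective
  rw [hsq, hsq, Matrix.star_mulVec, Matrix.dotProduct_mulVec, Matrix.vecMul_vecMul,
    ← Matrix.star_eq_conjTranspose, Matrix.mem_unitaryGroup_iff'.1 hU, Matrix.vecMul_one]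

theorem rotEps_nonneg (a b : ℕ) : 0 ≤ rotEps a b := by unfold rotEps; positivity

theorem rotEps_le_one (a b : ℕ) : rotEps a b ≤ 1 :=
  div_le_one_of_le₀ (one_le_pow₀ (by simp)) (by positivity)

theorem Kind.matrix_mem_unitaryGroup (k : Kind) : k.matrix ∈ Matrix.unitaryGroup Bool ℂ := by
  rw [Matrix.mem_unitaryGroup_iff]
  ext x y
  rw [Matrix.mul_apply, Fintype.sum_bool]
  cases k with
  | had =>
    have hsq : ((√2 : ℝ) : ℂ) * ((√2 : ℝ) : ℂ) = 2 := by
      rw [← Complex.ofReal_mul, Real.mul_self_sqrt zero_le_two, Complex.ofReal_ofNat]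
    cases x <;> cases y <;> simp [Kind.matrix, ← mul_inv, hsq] <;> norm_num
  | phase =>
    have hexp : Complex.exp (Real.pi / 4 * Complex.I) *
        (starRingEnd ℂ) (Complex.exp (Real.pi / 4 * Complex.I)) = 1 := by
      have hnorm := Complex.norm_exp_ofReal_mul_I (Real.pi / 4)
      push_cast at hnorm
      rw [Complex.mul_conj', hnorm]
      norm_num
    cases x <;> cases y <;> simp [Kind.matrix, hexp]
  | flip => cases x <;> cases y <;> simp [Kind.matrix]
  | rot a b =>
    have hcos : ((√(1 - rotEps a b) : ℝ) : ℂ) * ((√(1 - rotEps a b) : ℝ) : ℂ) =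
        1 - rotEps a b := by
      rw [← Complex.ofReal_mul, Real.mul_self_sqrt (sub_nonneg.2 (rotEps_le_one a b))]
      push_cast
      rfl
    have hsin : ((√(rotEps a b) : ℝ) : ℂ) * ((√(rotEps a b) : ℝ) : ℂ) = rotEps a b := by
      rw [← Complex.ofReal_mul, Real.mul_self_sqrt (rotEps_nonneg a b)]
    cases x <;> cases y <;> simp [Kind.matrix, hcos, hsin, mul_comm]

/-- The squared norm of a state. -/
noncomputable def normSq (ψ : StateVec n) : ℝ := ∑ x, ‖ψ x‖ ^ 2

theorem sum_sum_update {ι α M : Type*} [Fintype ι] [DecidableEq ι] [Fintype α] [AddCommMonoid M]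
    (i : ι) (f : (ι → α) → M) :
    ∑ x, ∑ a, f (update x i a) = Fintype.card α • ∑ x, f x := by
  have hsplit (g : (ι → α) → M) :
      ∑ x, g x = ∑ b, ∑ y, g ((Equiv.funSplitAt i α).symm (b, y)) := by
    rw [← (Equiv.funSplitAt i α).symm.sum_comp, Fintype.sum_prod_type]
  have hupdate (b a : α) (y : {j // j ≠ i} → α) :
      update ((Equiv.funSplitAt i α).symm (b, y)) i a = (Equiv.funSplitAt i α).symm (a, y) := by
    ext j
    obtain rfl | hj := eq_or_ne j i
    · simp [Equiv.funSplitAt, Equiv.piSplitAt]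
    · simp [Equiv.funSplitAt, Equiv.piSplitAt, hj]
  rw [hsplit, hsplit f]
  simp only [hupdate]
  rw [Finset.sum_const, Finset.card_univ, Finset.sum_comm]

theorem Gate.apply_of_controls (g : Gate n) (ψ : StateVec n) {x : Fin n → Bool}
    (hx : ∀ c ∈ g.controls, x c = true) :
    g.apply ψ x = g.kind.matrix.mulVec (fun b => ψ (update x g.target b)) (x g.target) :=
  if_pos hx

theorem Gate.apply_of_not_controls (g : Gate n) (ψ : StateVec n) {x : Fin n → Bool}
    (hx : ¬∀ c ∈ g.controls, x c = true) : g.apply ψ x = ψ x :=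
  if_neg hx

theorem Gate.controls_update_target (g : Gate n) (x : Fin n → Bool) (a : Bool) :
    (∀ c ∈ g.controls, update x g.target a c = true) ↔ ∀ c ∈ g.controls, x c = true := by
  refine forall₂_congr fun c hc => ?_
  rw [update_of_ne (ne_of_mem_of_not_mem hc (List.nodup_cons.1 g.distinct).1)]

theorem Gate.normSq_apply (g : Gate n) (ψ : StateVec n) : normSq (g.apply ψ) = normSq ψ := by
  refine nsmul_right_injective (Fintype.card_ne_zero (α := Bool)) ?_
  change _ • normSq _ = _ • normSq _
  rw [normSq, normSq, ← sum_sum_update g.target, ← sum_sum_update g.target]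
  refine Finset.sum_congr rfl fun x _ => ?_
  by_cases hx : ∀ c ∈ g.controls, x c = true
  · have happly (a : Bool) : g.apply ψ (update x g.target a) =
        g.kind.matrix.mulVec (fun b => ψ (update x g.target b)) a := by
      rw [g.apply_of_controls ψ ((g.controls_update_target x a).2 hx)]
      simp only [update_idem, update_self]
    simp only [happly]
    exact sum_norm_sq_mulVec g.kind.matrix_mem_unitaryGroup _
  · refine Finset.sum_congr rfl fun a _ => ?_
    rw [g.apply_of_not_controls ψ (mt (g.controls_update_target x a).1 hx)]

theorem normSq_zeroState (n : ℕ) : normSq (zeroState n) = 1 := by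
  simp [normSq, zeroState, apply_ite]

/-- The effect of a sequence of gates on a state. -/
noncomputable def evolve (l : List (Gate n)) (ψ : StateVec n) : StateVec n :=
  l.foldl (fun ψ g => g.apply ψ) ψ

theorem evolve_cons (g : Gate n) (l : List (Gate n)) (ψ : StateVec n) :
    evolve (g :: l) ψ = evolve l (g.apply ψ) := rfl

theorem evolve_append (l l' : List (Gate n)) (ψ : StateVec n) :
    evolve (l ++ l') ψ = evolve l' (evolve l ψ) := List.foldl_append

theorem normSq_evolve (l : List (Gate n)) (ψ : StateVec n) : normSq (evolve l ψ) = normSq ψ := by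
  induction l generalizing ψ with
  | nil => rfl
  | cons g l ih => rw [evolve_cons, ih, g.normSq_apply]

theorem Circuit.normSq_stateAfter (C : Circuit) (t : ℕ) : normSq (C.stateAfter t) = 1 :=
  (normSq_evolve _ _).trans (normSq_zeroState _)

theorem Circuit.probOne_nonneg (C : Circuit) : 0 ≤ C.probOne :=
  Finset.sum_nonneg fun x _ => by split_ifs <;> positivity

theorem Circuit.probOne_le_one (C : Circuit) : C.probOne ≤ 1 := by
  rw [← C.normSq_stateAfter C.gates.length]
  refine Finset.sum_le_sum fun x _ => ?_
  split_ifs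
  · rfl
  · positivity

/-! ### The states of the weakened circuit -/

theorem evolve_apply_zero {l : List (Gate n)} (hl : ∀ g ∈ l, g.controls ≠ []) (ψ : StateVec n) :
    evolve l ψ (fun _ => false) = ψ (fun _ => false) := by
  induction l generalizing ψ with
  | nil => rfl
  | cons g l ih =>
    obtain ⟨hg, hl⟩ := List.forall_mem_cons.1 hl
    rw [evolve_cons, ih hl, g.apply_of_not_controls]
    intro hzero
    obtain ⟨c, hc⟩ := List.exists_mem_of_ne_nil _ hg
    exact Bool.false_ne_true (hzero c hc)

/-- The state `c |0⟩|0…0⟩ + s |1⟩|φ⟩`. -/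
def branchState (c s : ℂ) (φ : StateVec n) : StateVec (n + 1) := fun x =>
  if x 0 then s * φ (Fin.tail x) else c * zeroState n (Fin.tail x)

theorem zeroState_cons (y : Bool) (z : Fin n → Bool) :
    zeroState (n + 1) (Fin.cons y z) = if y then 0 else zeroState n z := by
  have hzero : (fun _ => false : Fin (n + 1) → Bool) = Fin.cons false fun _ => false :=
    (Fin.cons_self_tail _).symm
  cases y <;> simp [zeroState, hzero, Fin.cons_inj]

theorem rot_apply_zeroState (n a b : ℕ) :
    (Gate.single (.rot a b) 0).apply (zeroState (n + 1)) =
      branchState (√(1 - rotEps a b) : ℝ) (√(rotEps a b) : ℝ) (zeroState n) := by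
  refine funext <| Fin.consCases fun y z => ?_
  cases y <;>
    simp [Gate.apply, Gate.single, branchState, Kind.matrix, Fin.update_cons_zero, zeroState_cons]

theorem Gate.controlled_apply_branchState (g : Gate n) (c s : ℂ) (φ : StateVec n) :
    g.controlled.apply (branchState c s φ) = branchState c s (g.apply φ) := by
  refine funext <| Fin.consCases fun y z => ?_
  cases y <;>
    simp [Gate.apply, Gate.controlled, branchState, ← Fin.cons_update, or_imp, forall_and,
      mul_add, mul_left_comm]

theorem evolve_controlled_branchState (l : List (Gate n)) (c s : ℂ) (φ : StateVec n) :
    evolve (l.map Gate.controlled) (branchState c s φ) = branchState c s (evolve l φ) := by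
  induction l generalizing φ with
  | nil => rfl
  | cons g l ih => rw [List.map_cons, evolve_cons, evolve_cons, g.controlled_apply_branchState, ih]

theorem phase_apply_zeroState (i : Fin n) :
    (Gate.single .phase i).apply (zeroState n) = zeroState n := by
  funext x
  have hx : update x i (x i) = x := update_eq_self i x
  cases hi : x i
  · simp [Gate.apply, Gate.single, Kind.matrix, hi, hi ▸ hx]
  · have hzero : zeroState n x = 0 := if_neg fun h => by simp [h] at hi
    simp [Gate.apply, Gate.single, Kind.matrix, hi, hi ▸ hx, hzero]

theorem flip_apply (i : Fin n) (ψ : StateVec n) (x : Fin n → Bool) :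
    (Gate.single .flip i).apply ψ x = ψ (update x i (!x i)) := by
  cases h : x i <;> simp [Gate.apply, Gate.single, Kind.matrix, h]

theorem cnot_apply (i j : Fin n) (h : i ≠ j) (ψ : StateVec n) (x : Fin n → Bool) :
    (Gate.cnot i j h).apply ψ x = if x j then ψ (update x i (!x i)) else ψ x := by
  cases h : x i <;> simp [Gate.apply, Gate.cnot, Kind.matrix, h]

theorem Circuit.evolve_body (C : Circuit) :
    evolve C.body (zeroState C.n) =
      (Gate.single .flip C.first).apply (C.stateAfter C.gates.length) := by
  rw [Circuit.body, evolve_append, evolve_cons (Gate.single .phase _), phase_apply_zeroState,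
    Circuit.stateAfter, List.take_length]
  rfl

theorem Circuit.stateAfter_weaken_length (C : Circuit) (b : ℕ) :
    (C.weaken b).stateAfter (C.weaken b).gates.length =
      (Gate.cnot 0 C.first.succ (Fin.succ_ne_zero _).symm).apply
        (branchState (√(1 - rotEps C.n b) : ℝ) (√(rotEps C.n b) : ℝ)
          ((Gate.single .flip C.first).apply (C.stateAfter C.gates.length))) := by
  rw [← Circuit.evolve_body, ← evolve_controlled_branchState, ← rot_apply_zeroState,
    Circuit.stateAfter, List.take_length]
  exact evolve_append _ _ _

theorem Circuit.le_norm_sq_stateAfter_weaken_zero (C : Circuit) (b t : ℕ) :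
    1 - rotEps C.n b ≤ ‖(C.weaken b).stateAfter t (fun _ => false)‖ ^ 2 := by
  cases t with
  | zero => simp [Circuit.stateAfter, zeroState, rotEps_nonneg]
  | succ t =>
    have hcontrols : ∀ g ∈ C.body.map Gate.controlled ++
        [Gate.cnot 0 C.first.succ (Fin.succ_ne_zero _).symm], g.controls ≠ [] := by
      refine List.forall_mem_append.2 ⟨List.forall_mem_map.2 fun g _ => ?_, ?_⟩ <;>
        simp [Gate.controlled, Gate.cnot]
    have hstate : (C.weaken b).stateAfter (t + 1) (fun _ => false) =
        (√(1 - rotEps C.n b) : ℝ) := by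
      refine (evolve_apply_zero (fun g hg => hcontrols g (List.mem_of_mem_take hg)) _).trans ?_
      refine (congrFun (rot_apply_zeroState _ _ _) _).trans ?_
      simp [branchState, zeroState, Fin.tail_def]
    rw [hstate, Complex.norm_real, Real.norm_eq_abs, sq_abs,
      Real.sq_sqrt (sub_nonneg.2 (rotEps_le_one _ _))]

theorem cnot_flip_apply_branchState_cons_true (i : Fin n) (c s : ℂ) (φ : StateVec n)
    (z : Fin n → Bool) :
    (Gate.cnot 0 i.succ (Fin.succ_ne_zero _).symm).apply
        (branchState c s ((Gate.single .flip i).apply φ)) (Fin.cons true z) =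
      if z i then 0 else s * φ (update z i true) := by
  rw [cnot_apply]
  cases hz : z i
  · simp [hz, branchState, flip_apply]
  · have hzero : zeroState n z = 0 := if_neg fun h => by simp [h] at hz
    simp [hz, branchState, Fin.update_cons_zero, hzero]

theorem sum_ite_update_true {M : Type*} [AddCommMonoid M] (i : Fin n)
    (f : (Fin n → Bool) → M) :
    ∑ z, (if z i then 0 else f (update z i true)) = ∑ z, if z i then f z else 0 := by
  have hinvol : Involutive fun z : Fin n → Bool => update z i (!z i) := fun z => by simp
  rw [← Equiv.sum_comp hinvol.toPerm]
  refine Finset.sum_congr rfl fun z _ => ?_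
  have hupdate : update z i (z i) = z := update_eq_self i z
  cases hz : z i <;> simp [hz, hz ▸ hupdate]

theorem Circuit.probOne_weaken (C : Circuit) (b : ℕ) :
    (C.weaken b).probOne = rotEps C.n b * C.probOne := by
  set s : ℂ := ((√(rotEps C.n b) : ℝ) : ℂ) with hs
  have hnorm : ‖s‖ ^ 2 = rotEps C.n b := by simp [hs, Real.sq_sqrt (rotEps_nonneg C.n b)]
  have hamplitude (z : Fin C.n → Bool) :
      (C.weaken b).stateAfter (C.weaken b).gates.length (Fin.cons true z) =
        if z C.first then 0 else s * C.stateAfter C.gates.length (update z C.first true) :=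
    (congrFun (C.stateAfter_weaken_length b) _).trans
      (cnot_flip_apply_branchState_cons_true C.first _ s _ z)
  have hsplit (f : (Fin (C.n + 1) → Bool) → ℝ) :
      ∑ x, (if x 0 then f x else 0) = ∑ z : Fin C.n → Bool, f (Fin.cons true z) := by
    rw [← (Fin.consEquiv fun _ => Bool).sum_comp, Fintype.sum_prod_type, Fintype.sum_bool]
    simp [Fin.consEquiv]
  calc (C.weaken b).probOne
    _ = ∑ z, ‖(C.weaken b).stateAfter (C.weaken b).gates.length (Fin.cons true z)‖ ^ 2 :=
      hsplit fun x => ‖(C.weaken b).stateAfter _ x‖ ^ 2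
    _ = ∑ z, if z C.first then 0
          else rotEps C.n b * ‖C.stateAfter C.gates.length (update z C.first true)‖ ^ 2 := by
      refine Finset.sum_congr rfl fun z _ => ?_
      rw [hamplitude]
      split_ifs
      · simp
      · rw [norm_mul, mul_pow, hnorm]
    _ = ∑ z, if z C.first then rotEps C.n b * ‖C.stateAfter C.gates.length z‖ ^ 2 else 0 :=
      sum_ite_update_true C.first fun z => rotEps C.n b * ‖C.stateAfter C.gates.length z‖ ^ 2
    _ = rotEps C.n b * C.probOne := by
      simp only [Circuit.probOne, Finset.mul_sum, mul_ite, mul_zero]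
      rfl

/-! ### Entropy of a state close to a product state -/

open scoped ComplexOrder Matrix

theorem sum_glue {M : Type*} [AddCommMonoid M] (A : Finset (Fin n)) (f : (Fin n → Bool) → M) :
    ∑ x, ∑ z, f (glue A x z) = ∑ x, f x := by
  rw [← Equiv.sum_comp (Equiv.piEquivPiSubtypeProd (· ∈ A) fun _ => Bool).symm,
    Fintype.sum_prod_type]
  rfl

theorem reduced_eq_mul_conjTranspose (ψ : StateVec n) (A : Finset (Fin n)) :
    reduced ψ A = Matrix.of (fun x z => ψ (glue A x z)) *
      (Matrix.of fun x z => ψ (glue A x z))ᴴ := by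
  ext x y
  simp [reduced, Matrix.mul_apply]

theorem posSemidef_reduced (ψ : StateVec n) (A : Finset (Fin n)) : (reduced ψ A).PosSemidef := by
  rw [reduced_eq_mul_conjTranspose]
  exact Matrix.posSemidef_self_mul_conjTranspose _

theorem reduced_apply_self (ψ : StateVec n) (A : Finset (Fin n)) (x : {i // i ∈ A} → Bool) :
    reduced ψ A x x = ((∑ z, ‖ψ (glue A x z)‖ ^ 2 : ℝ) : ℂ) := by
  simp [reduced, Complex.mul_conj']

theorem norm_sq_zero_le_re_reduced (ψ : StateVec n) (A : Finset (Fin n)) :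
    ‖ψ (fun _ => false)‖ ^ 2 ≤ RCLike.re (reduced ψ A (fun _ => false) (fun _ => false)) := by
  have hglue : glue A (fun _ => false) (fun _ => false) = fun _ => false :=
    funext fun i => by simp [glue]
  rw [reduced_apply_self, RCLike.re_eq_complex_re, Complex.ofReal_re]
  nth_rw 1 [← hglue]
  exact Finset.single_le_sum (f := fun z => ‖ψ (glue A _ z)‖ ^ 2) (fun _ _ => by positivity)
    (Finset.mem_univ _)

theorem sum_eigenvalues_reduced (ψ : StateVec n) (A : Finset (Fin n)) :
    ∑ i, (reduced_isHermitian ψ A).eigenvalues i = normSq ψ := by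
  apply Complex.ofReal_injective
  rw [Complex.ofReal_sum, normSq, ← sum_glue A, Complex.ofReal_sum]
  refine (reduced_isHermitian ψ A).trace_eq_sum_eigenvalues.symm.trans ?_
  exact Finset.sum_congr rfl fun x _ => reduced_apply_self ψ A x

section Eigenvalues

variable {𝕜 ι : Type*} [RCLike 𝕜] [Fintype ι] [DecidableEq ι]

theorem sum_norm_sq_row_of_mem_unitaryGroup {U : Matrix ι ι 𝕜} (hU : U ∈ Matrix.unitaryGroup ι 𝕜)
    (k : ι) : ∑ i, ‖U k i‖ ^ 2 = 1 := by
  have hkk := congrFun₂ (Matrix.mem_unitaryGroup_iff.1 hU) k k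
  simp only [Matrix.mul_apply, Matrix.star_apply, RCLike.star_def, RCLike.mul_conj,
    Matrix.one_apply_eq] at hkk
  exact_mod_cast hkk

theorem re_apply_self_eq_sum_eigenvalues {ρ : Matrix ι ι 𝕜} (hρ : ρ.IsHermitian) (k : ι) :
    RCLike.re (ρ k k) =
      ∑ i, hρ.eigenvalues i * ‖(hρ.eigenvectorUnitary : Matrix ι ι 𝕜) k i‖ ^ 2 := by
  have hkk := congrFun₂ hρ.spectral_theorem k k
  rw [Unitary.conjStarAlgAut_apply, Matrix.mul_apply] at hkk
  rw [hkk, map_sum]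
  refine Finset.sum_congr rfl fun i _ => ?_
  rw [Matrix.mul_diagonal, Matrix.star_apply, RCLike.star_def, mul_right_comm, RCLike.mul_conj,
    mul_comm, comp_apply]
  exact_mod_cast RCLike.ofReal_re (K := 𝕜) _

theorem exists_re_apply_self_le_eigenvalues {ρ : Matrix ι ι 𝕜} (hρ : ρ.IsHermitian) (k : ι) :
    ∃ i, RCLike.re (ρ k k) ≤ hρ.eigenvalues i := by
  have : Nonempty ι := ⟨k⟩
  obtain ⟨i, hi⟩ := Finite.exists_max hρ.eigenvalues
  refine ⟨i, ?_⟩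
  calc RCLike.re (ρ k k)
    _ = ∑ j, hρ.eigenvalues j * ‖(hρ.eigenvectorUnitary : Matrix ι ι 𝕜) k j‖ ^ 2 :=
      re_apply_self_eq_sum_eigenvalues hρ k
    _ ≤ ∑ j, hρ.eigenvalues i * ‖(hρ.eigenvectorUnitary : Matrix ι ι 𝕜) k j‖ ^ 2 := by
      gcongr with j
      exact hi j
    _ = hρ.eigenvalues i := by
      rw [← Finset.mul_sum, sum_norm_sq_row_of_mem_unitaryGroup hρ.eigenvectorUnitary.2, mul_one]

end Eigenvalues

theorem negMulLog_le_mul_neg_log_add_sub {x q : ℝ} (hx : 0 ≤ x) (hq : 0 < q) :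
    Real.negMulLog x ≤ x * -Real.log q + (q - x) := by
  have htangent := mul_le_mul_of_nonneg_left
    (Real.negMulLog_le_one_sub_self (div_nonneg hx hq.le)) hq.le
  have hscale : Real.negMulLog x = x * -Real.log q + q * Real.negMulLog (x / q) := by
    conv_lhs => rw [← div_mul_cancel₀ x hq.ne', Real.negMulLog_mul]
    simp only [Real.negMulLog]
    field_simp
    ring
  have hcancel : q * (1 - x / q) = q - x := by field_simp
  linarith

theorem sum_negMulLog_le_of_one_sub_le {ι : Type*} [Fintype ι] {p : ι → ℝ} (hp : ∀ i, 0 ≤ p i)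
    (hsum : ∑ i, p i = 1) {ε : ℝ} (hε : 0 < ε) (hε' : ε ≤ 1) {i₀ : ι} (hi₀ : 1 - ε ≤ p i₀) :
    ∑ i, Real.negMulLog (p i) ≤ ε * (1 + Real.log (Fintype.card ι) + Real.log (1 / ε)) := by
  classical
  set d := (Fintype.card ι : ℝ)
  set L := Real.log d + Real.log (1 / ε)
  have hd : 1 ≤ d := Nat.one_le_cast.2 (Fintype.card_pos_iff.2 ⟨i₀⟩)
  have hL : 0 ≤ L := add_nonneg (Real.log_nonneg hd) (Real.log_nonneg (one_le_one_div hε hε'))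
  have hlog : -Real.log (ε / d) = L := by
    rw [Real.log_div hε.ne' (by positivity), neg_sub, sub_eq_add_neg, ← Real.log_inv, ← one_div]
  have hrest : ∑ i ∈ Finset.univ.erase i₀, p i = 1 - p i₀ := by
    rw [← hsum, ← Finset.add_sum_erase _ _ (Finset.mem_univ i₀), add_sub_cancel_left]
  have hcard : ∑ _ ∈ Finset.univ.erase i₀, ε / d ≤ ε := by
    rw [Finset.sum_const, nsmul_eq_mul, mul_div_left_comm]
    refine mul_le_of_le_one_right hε.le (div_le_one_of_le₀ ?_ (by positivity))
    exact Nat.cast_le.2 Finset.card_erase_le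
  calc ∑ i, Real.negMulLog (p i)
    _ = Real.negMulLog (p i₀) + ∑ i ∈ Finset.univ.erase i₀, Real.negMulLog (p i) :=
      (Finset.add_sum_erase _ _ (Finset.mem_univ i₀)).symm
    _ ≤ (1 - p i₀) + ∑ i ∈ Finset.univ.erase i₀, (p i * L + (ε / d - p i)) := by
      rw [← hlog]
      gcongr with i
      · exact Real.negMulLog_le_one_sub_self (hp i₀)
      · exact negMulLog_le_mul_neg_log_add_sub (hp i) (by positivity)
    _ = (1 - p i₀) * L + ∑ _ ∈ Finset.univ.erase i₀, ε / d := by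
      rw [Finset.sum_add_distrib, ← Finset.sum_mul, Finset.sum_sub_distrib, hrest]
      ring
    _ ≤ ε * L + ε := by
      gcongr
      linarith
    _ = ε * (1 + Real.log d + Real.log (1 / ε)) := by ring

theorem vonNeumannEntropy_eq_sum_negMulLog_div {ι : Type*} [Fintype ι] [DecidableEq ι]
    {ρ : Matrix ι ι ℂ} (hρ : ρ.IsHermitian) :
    vonNeumannEntropy hρ = (∑ i, Real.negMulLog (hρ.eigenvalues i)) / Real.log 2 := by
  simp only [vonNeumannEntropy, Real.negMulLog, Real.logb, ← Finset.sum_neg_distrib,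
    Finset.sum_div, neg_mul, mul_div_assoc, neg_div]

theorem entanglementEntropy_le {ψ : StateVec n} (hψ : normSq ψ = 1) {ε : ℝ} (hε : 0 < ε)
    (hε' : ε ≤ 1) (h0 : 1 - ε ≤ ‖ψ (fun _ => false)‖ ^ 2) (A : Finset (Fin n)) :
    entanglementEntropy ψ A ≤ ε * (2 + n + Real.logb 2 (1 / ε)) := by
  have hρ := reduced_isHermitian ψ A
  obtain ⟨i₀, hi₀⟩ := exists_re_apply_self_le_eigenvalues hρ fun _ => false
  have hsum := sum_negMulLog_le_of_one_sub_le (posSemidef_reduced ψ A).eigenvalues_nonneg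
    ((sum_eigenvalues_reduced ψ A).trans hψ) hε hε'
    (h0.trans ((norm_sq_zero_le_re_reduced ψ A).trans hi₀))
  have hlog : 0 < Real.log 2 := Real.log_pos one_lt_two
  have hlog_inv : 1 / Real.log 2 ≤ 2 := by
    rw [div_le_iff₀ hlog]
    linarith [Real.log_two_gt_d9]
  have hcard : Real.log (Fintype.card ({i // i ∈ A} → Bool)) / Real.log 2 ≤ n := by
    rw [Fintype.card_fun, Fintype.card_bool, Fintype.card_coe, Nat.cast_pow, Real.log_pow,
      Nat.cast_ofNat, mul_div_cancel_right₀ _ hlog.ne']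
    exact_mod_cast (Finset.card_le_univ A).trans_eq (Fintype.card_fin n)
  rw [entanglementEntropy, vonNeumannEntropy_eq_sum_negMulLog_div]
  calc _ ≤ ε * (1 + Real.log (Fintype.card ({i // i ∈ A} → Bool)) + Real.log (1 / ε)) /
        Real.log 2 := by gcongr
    _ = ε * (1 / Real.log 2 + Real.log (Fintype.card ({i // i ∈ A} → Bool)) / Real.log 2 +
        Real.logb 2 (1 / ε)) := by
      rw [Real.logb]
      ring
    _ ≤ ε * (2 + n + Real.logb 2 (1 / ε)) := by gcongr

theorem Circuit.entropyAtMost_weaken (C : Circuit) (k : ℕ) :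
    (C.weaken (k + 1)).EntropyAtMost ((k + 4) * (1 / ((C.weaken (k + 1)).n : ℝ) ^ k)) := by
  intro t _ A
  set m : ℝ := ((C.weaken (k + 1)).n : ℝ)
  have hm : 1 ≤ m := Nat.one_le_cast.2 (C.weaken (k + 1)).pos
  have hε : rotEps C.n (k + 1) = 1 / m ^ (k + 1) := by
    rw [rotEps, ← Nat.cast_succ]
    rfl
  have hlogb : Real.logb 2 (1 / (1 / m ^ (k + 1))) ≤ (k + 1) * m := by
    rw [one_div_one_div, Real.logb_pow, Nat.cast_succ]
    gcongr
    rw [Real.logb_le_iff_le_rpow one_lt_two (by positivity), Real.rpow_natCast]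
    exact (Nat.cast_le.2 Nat.lt_two_pow_self.le).trans_eq (by rw [Nat.cast_pow, Nat.cast_ofNat])
  have hbound := entanglementEntropy_le ((C.weaken (k + 1)).normSq_stateAfter t)
    (hε ▸ by positivity) (rotEps_le_one _ _) (C.le_norm_sq_stateAfter_weaken_zero _ t) A
  rw [hε] at hbound
  calc _ ≤ 1 / m ^ (k + 1) * (2 + m + Real.logb 2 (1 / (1 / m ^ (k + 1)))) := hbound
    _ ≤ 1 / m ^ (k + 1) * (2 * m + m + (k + 1) * m) := by
      gcongr
      linarith
    _ = (k + 4) * (1 / m ^ k) := by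
      field_simp
      ring

theorem PolynomiallySmall.exists_one_div_pow_le {δ : ℕ → ℝ} (hδ : PolynomiallySmall δ) :
    ∃ (k : ℕ) (c : ℝ), 0 < c ∧ ∀ n : ℕ, 1 ≤ n → 1 / (n : ℝ) ^ k ≤ c * δ n := by
  obtain ⟨hpos, p, hp⟩ := hδ
  have hpow : (fun n : ℕ => 1 / δ n) =O[Filter.atTop] fun n : ℕ => (n : ℝ) ^ p.natDegree := by
    have hdegree := Polynomial.isBigO_atTop_of_degree_le p (Polynomial.X ^ p.natDegree)
      (by simp [p.degree_le_natDegree])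
    simp only [Polynomial.eval_pow, Polynomial.eval_X] at hdegree
    exact hp.trans (hdegree.comp_tendsto tendsto_natCast_atTop_atTop)
  obtain ⟨c, hc, hbound⟩ := Asymptotics.bound_of_isBigO_nat_atTop hpow
  refine ⟨p.natDegree, c, hc, fun n hn => ?_⟩
  have hn' : (0 : ℝ) < (n : ℝ) ^ p.natDegree := by positivity
  have hδn := hpos n hn
  have hle : 1 / δ n ≤ c * (n : ℝ) ^ p.natDegree := by
    simpa only [Real.norm_of_nonneg (one_div_pos.2 hδn).le, Real.norm_of_nonneg hn'.le]
      using hbound hn'.ne'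
  rw [div_le_iff₀ hδn] at hle
  rw [div_le_iff₀ hn']
  linarith

/-! ### Amplification -/

theorem sum_binomial_le_of_le_abs_sub (T : ℕ) {q : ℝ} (hq0 : 0 ≤ q) (hq1 : q ≤ 1) {S : Finset ℕ}
    (hS : S ⊆ Finset.range (T + 1)) {r : ℝ} (hr : 0 < r) (hdev : ∀ k ∈ S, r ≤ |T * q - k|) :
    ∑ k ∈ S, (T.choose k : ℝ) * q ^ k * (1 - q) ^ (T - k) ≤ T * q * (1 - q) / r ^ 2 := by
  have hvariance := congrArg (Polynomial.eval q) (bernsteinPolynomial.variance ℝ T)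
  simp only [Polynomial.eval_finsetSum, bernsteinPolynomial, Polynomial.eval_mul,
    Polynomial.eval_pow, Polynomial.eval_sub, Polynomial.eval_X, Polynomial.eval_natCast,
    Polynomial.eval_one, nsmul_eq_mul] at hvariance
  have hweight (k : ℕ) : 0 ≤ (T.choose k : ℝ) * q ^ k * (1 - q) ^ (T - k) := by
    have := sub_nonneg.2 hq1
    positivity
  rw [le_div_iff₀ (by positivity), ← hvariance, Finset.sum_mul]
  calc ∑ k ∈ S, (T.choose k : ℝ) * q ^ k * (1 - q) ^ (T - k) * r ^ 2
    _ ≤ ∑ k ∈ S, (T * q - k) ^ 2 * ((T.choose k : ℝ) * q ^ k * (1 - q) ^ (T - k)) := by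
      refine Finset.sum_le_sum fun k hk => ?_
      rw [mul_comm, ← sq_abs (T * q - k)]
      exact mul_le_mul_of_nonneg_right (pow_le_pow_left₀ hr.le (hdev k hk) 2) (hweight k)
    _ ≤ ∑ k ∈ Finset.range (T + 1),
          (T * q - k) ^ 2 * ((T.choose k : ℝ) * q ^ k * (1 - q) ^ (T - k)) :=
      Finset.sum_le_sum_of_subset_of_nonneg hS fun k _ _ => mul_nonneg (sq_nonneg _) (hweight k)

theorem sum_range_binomial (T : ℕ) (q : ℝ) :
    ∑ k ∈ Finset.range (T + 1), (T.choose k : ℝ) * q ^ k * (1 - q) ^ (T - k) = 1 := by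
  have hbinomial := (add_pow q (1 - q) T).symm
  rw [add_sub_cancel, one_pow] at hbinomial
  exact (Finset.sum_congr rfl fun k _ => by ring).trans hbinomial

theorem Icc_subset_range_succ (k T : ℕ) : Finset.Icc k T ⊆ Finset.range (T + 1) := by
  rw [Nat.range_succ_eq_Icc_zero]
  exact Finset.Icc_subset_Icc_left k.zero_le

theorem Circuit.probAtLeast_le (C : Circuit) {T θ : ℕ} (h : T * C.probOne < θ) :
    C.probAtLeast T θ ≤ T * C.probOne * (1 - C.probOne) / (θ - T * C.probOne) ^ 2 := by
  refine sum_binomial_le_of_le_abs_sub T C.probOne_nonneg C.probOne_le_one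
    (Icc_subset_range_succ θ T) (sub_pos.2 h) fun k hk => ?_
  have hk : (θ : ℝ) ≤ k := Nat.cast_le.2 (Finset.mem_Icc.1 hk).1
  rw [abs_sub_comm]
  exact (sub_le_sub_right hk _).trans (le_abs_self _)

theorem Circuit.one_sub_le_probAtLeast (C : Circuit) {T θ : ℕ} (h : θ < T * C.probOne) :
    1 - T * C.probOne * (1 - C.probOne) / (T * C.probOne - θ) ^ 2 ≤ C.probAtLeast T θ := by
  have hbelow := sum_binomial_le_of_le_abs_sub T C.probOne_nonneg C.probOne_le_one
    (S := Finset.range (T + 1) \ Finset.Icc θ T) Finset.sdiff_subset (sub_pos.2 h) (by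
      intro k hk
      rw [Finset.mem_sdiff, Finset.mem_range, Finset.mem_Icc] at hk
      have hk : (k : ℝ) ≤ θ := Nat.cast_le.2 (by lia)
      exact (sub_le_sub_left hk _).trans (le_abs_self _))
  have htotal := sum_range_binomial T C.probOne
  rw [← Finset.sum_sdiff (Icc_subset_range_succ θ T)] at htotal
  rw [Circuit.probAtLeast]
  linarith

theorem Circuit.runs_mul_probOne_weaken (C : Circuit) (m b : ℕ) :
    ((m * (C.weaken b).n ^ b : ℕ) : ℝ) * (C.weaken b).probOne = m * C.probOne := by
  rw [C.probOne_weaken, rotEps, show (C.weaken b).n = C.n + 1 from rfl]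
  push_cast
  field_simp

/-- In `72 * n ^ b` runs the expected number of outcomes `1` is `72 * C.probOne`, hence at least
`48` or at most `24`, and the variance is at most the expectation; the threshold `36` is halfway. -/
theorem Circuit.two_thirds_le_probAtLeast_weaken {C : Circuit} (h : 2 / 3 ≤ C.probOne) (b : ℕ) :
    2 / 3 ≤ (C.weaken b).probAtLeast (72 * (C.weaken b).n ^ b) 36 := by
  have hmean := C.runs_mul_probOne_weaken 72 b
  rw [Nat.cast_ofNat] at hmean
  have hchebyshev := (C.weaken b).one_sub_le_probAtLeast (T := 72 * (C.weaken b).n ^ b) (θ := 36)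
    (by rw [hmean, Nat.cast_ofNat]; linarith)
  rw [hmean, Nat.cast_ofNat] at hchebyshev
  have hvariance : 72 * C.probOne * (1 - (C.weaken b).probOne) ≤ 72 * C.probOne :=
    mul_le_of_le_one_right (by linarith) (by linarith [(C.weaken b).probOne_nonneg])
  have htail : 72 * C.probOne * (1 - (C.weaken b).probOne) / (72 * C.probOne - 36) ^ 2 ≤ 1 / 3 := by
    refine div_le_of_le_mul₀ (by positivity) (by norm_num) (hvariance.trans ?_)
    nlinarith
  linarith

theorem Circuit.probAtLeast_weaken_le_one_third {C : Circuit} (h : C.probOne ≤ 1 / 3) (b : ℕ) :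
    (C.weaken b).probAtLeast (72 * (C.weaken b).n ^ b) 36 ≤ 1 / 3 := by
  have hmean := C.runs_mul_probOne_weaken 72 b
  rw [Nat.cast_ofNat] at hmean
  have hchebyshev := (C.weaken b).probAtLeast_le (T := 72 * (C.weaken b).n ^ b) (θ := 36)
    (by rw [hmean, Nat.cast_ofNat]; linarith)
  rw [hmean, Nat.cast_ofNat] at hchebyshev
  have hvariance : 72 * C.probOne * (1 - (C.weaken b).probOne) ≤ 72 * C.probOne :=
    mul_le_of_le_one_right (by linarith [C.probOne_nonneg])
      (by linarith [(C.weaken b).probOne_nonneg])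
  refine hchebyshev.trans <|
    div_le_of_le_mul₀ (by positivity) (by norm_num) (hvariance.trans ?_)
  nlinarith [C.probOne_nonneg]

end LowEntQC

theorem mainTheorem2 (δ : ℕ → ℝ) (hδ : LowEntQC.PolynomiallySmall δ) :
    ∃ C : ℝ, 0 < C ∧ ∀ P : LowEntQC.PromiseProblem, LowEntQC.InBQP P →
      LowEntQC.SolvableWithEntropyAtMost (fun n => C * δ n) P := by
  obtain ⟨k, c, hc, hδ_ge⟩ := hδ.exists_one_div_pow_le
  refine ⟨(k + 4) * c, by positivity, ?_⟩
  rintro P ⟨F, huniform, hbasic, hyes, hno⟩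
  have hentropy (x : List Bool) : ((F x).weaken (k + 1)).EntropyAtMost
      ((k + 4) * c * δ ((F x).weaken (k + 1)).n) := fun t ht A =>
    ((F x).entropyAtMost_weaken k t ht A).trans <| by
      rw [mul_assoc]
      gcongr
      exact hδ_ge _ ((F x).weaken (k + 1)).pos
  refine ⟨fun x => (F x).weaken (k + 1), huniform.weaken (k + 1), fun x => ?_, hentropy,
    72 * Polynomial.X ^ (k + 1), 36, fun x hx => ?_, fun x hx => ?_⟩
  · exact LowEntQC.Circuit.arity_weaken_le one_le_two (fun g hg => (hbasic x g hg).arity_le_two) _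
  · simpa using LowEntQC.Circuit.two_thirds_le_probAtLeast_weaken (hyes x hx) (k + 1)
  · simpa using LowEntQC.Circuit.probAtLeast_weaken_le_one_third (hno x hx) (k + 1)
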